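/- **Theorem (equivalence of spectral projections in smooth subalgebras).** *Setting.* Let $\mathfrak A$ be a $C^*$-algebra and $\pi:\mathfrak A\to B(\mathcal H)$ a faithful $*$-representation on a Hilbert space. Let $\mathfrak A_0\subset\mathfrak A$ be a *smooth subalgebra*: a dense $*$-subalgebra such that its unitization $\widetilde{\mathfrak A}_0$ is stable under the holomorphic functional calculus of the unitization $\widetilde{\mathfrak A}$, i.e. $f(a)\in\widetilde{\mathfrak A}_0$ for every $a\in\widetilde{\mathfrak A}_0$ and every $f$ holomorphic in a neighbourhood of the spectrum of $a$ in $\widetilde{\mathfrak A}$. Let $\mathcal H_1,\mathcal H_2,\mathcal H_0$ be Hilbert spaces and $\mathcal V_l:\mathcal H_l\to\mathcal H$ ($l=1,2$) unitary operators. Let $A_l$ be a self-adjoint operator in $\mathcal H_l$ with $(A_lu,u)\ge\lambda_{0l}\|u\|^2$ on $\operatorname{Dom}(A_l)$, where $\lambda_{0l}\le 0$, such that for every $t>0$ one has $\mathcal V_le^{-tA_l}\mathcal V_l^{-1}\in\pi(\mathfrak A_0)$. Assume that there is a faithful normal semi-finite trace $\tau$ on the von Neumann algebra $\pi(\mathfrak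 A)''$ with $\tau(\mathcal V_le^{-tA_l}\mathcal V_l^{-1})<\infty$ for all $t>0$, $l=1,2$. Let $i_l:\mathcal H_0\to\mathcal H_l$ and $p_l:\mathcal H_l\to\mathcal H_0$ be bounded linear maps with $p_l i_l=\mathrm{id}$, and let $J$ be a bounded self-adjoint operator in $\mathcal H_0$ such that - $\mathcal V_2i_2Jp_1\mathcal V_1^{-1}\in\pi(\mathfrak A)''$, $(i_2Jp_1)^*=i_1Jp_2$, and $\pi(a)\mathcal V_2i_2Jp_1\mathcal V_1^{-1}\in\pi(\mathfrak A)$ for all $a\in\mathfrak A$; - $\rho^{-1}\|i_2Ju\|\le\|i_1Ju\|\le\rho\|i_2Ju\|$ for all $u\in\mathcal H_0$, with some $\rho>1$; - the operators $J_l=i_lJp_l$ are self-adjoint with $0\le J_l\le \mathrm{id}$ and, for $u\in \mathcal H_0$, $i_1Ju\in\operatorname{Dom}(A_1)$ if and only if $i_2Ju\in\operatorname{Dom}(A_2)$; - $J_l$ and $J_l'=(\mathrm{id}-J_l^2)^{1/2}$ map $\operatorname{Dom}(A_l)$ into itself, and $[J_l,[J_l,A_l]]$, $[J'_l,[J'_l,A_l]]$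 extend to bounded operators of norm at most $\gamma_l$; - $(A_lJ_l'u,J_l'u)\ge\alpha_l\|J_l'u\|^2$ for $u\in\operatorname{Dom}(A_l)$, with some $\alpha_l>0$; - for all $u\in\mathcal H_0$ with $i_1Ju\in\operatorname{Dom}(A_1)$, and with some $\beta_1,\beta_2\ge1$ and $\varepsilon_1,\varepsilon_2>0$, $$(A_2i_2Ju,i_2Ju)\le\beta_1(A_1i_1Ju,i_1Ju)+\varepsilon_1\|i_1Ju\|^2,\qquad (A_1i_1Ju,i_1Ju)\le\beta_2(A_2i_2Ju,i_2Ju)+\varepsilon_2\|i_2Ju\|^2 .$$ Let $E_l(\lambda)=\chi_{(-\infty,\lambda]}(A_l)$ be the spectral projections. *Statement.* Let $b_1>a_1$ and $$a_2=\rho\left[\beta_1\left(a_1+\gamma_1+\frac{(a_1+\gamma_1-\lambda_{01})^2}{\alpha_1-a_1-\gamma_1}\right)+\varepsilon_1\right],\qquad b_2=\frac{\beta_2^{-1}(b_1\rho^{-1}-\varepsilon_2)(\alpha_2-\gamma_2)-\alpha_2\gamma_2+2\lambda_{02}\gamma_2-\lambda_{02}^2}{\alpha_2-2\lambda_{02}+\beta_2^{-1}(b_1\rho^{-1}-\varepsilon_2)}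 .$$ Suppose that $\alpha_1>a_1+\gamma_1$, $\alpha_2>b_2+\gamma_2$, $b_2>a_2\ge 0$, and that the interval $(a_1,b_1)$ does not intersect the spectrum of $A_1$. Then for any $\lambda_1\in(a_1,b_1)$ and $\lambda_2\in(a_2,b_2)$ the projections $P=\mathcal V_1E_1(\lambda_1)\mathcal V_1^{-1}$ and $Q=\mathcal V_2E_2(\lambda_2)\mathcal V_2^{-1}$ belong to $\pi(\mathfrak A_0)$ and are Murray–von Neumann equivalent in $\pi(\mathfrak A_0)$: there is $U\in\pi(\mathfrak A_0)$ with $U^*U=P$ and $UU^*=Q$. -/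

import Mathlib

open scoped ENNReal NNReal ZeroAtInfty InnerProductSpace

noncomputable section

namespace SpectralEquiv

/-! ### Unbounded self-adjoint operators -/

section Unbounded

variable {H : Type*} [NormedAddCommGroup H] [InnerProductSpace ℂ H]

/-- `R` is a bounded two-sided inverse `(A - z)⁻¹` of `A - z : Dom A → H`. -/
def IsResolventAt (A : H →ₗ.[ℂ] H) (z : ℂ) (R : H →L[ℂ] H) : Prop :=
  (∀ v : H, ∃ h : R v ∈ A.domain, A ⟨R v, h⟩ - z • R v = v) ∧
    ∀ u : A.domain, R (A u - z • (u : H)) = u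

/-- The spectrum of an unbounded operator. -/
def opSpectrum (A : H →ₗ.[ℂ] H) : Set ℂ :=
  {z | ¬ ∃ R : H →L[ℂ] H, IsResolventAt A z R}

open Classical in
/-- The resolvent `(A - z)⁻¹` (and `0` if `z` lies in the spectrum). -/
def resolventOp (A : H →ₗ.[ℂ] H) (z : ℂ) : H →L[ℂ] H :=
  if h : ∃ R : H →L[ℂ] H, IsResolventAt A z R then h.choose else 0

/-- The lower bound `(A u, u) ≥ c ‖u‖²` on `Dom A`. -/
def IsBoundedBelowBy (A : H →ₗ.[ℂ] H) (c : ℝ) : Prop :=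
  ∀ u : A.domain, c * ‖(u : H)‖ ^ 2 ≤ (⟪A u, (u : H)⟫_ℂ).re

/-- `K` maps `Dom A` into itself. -/
def PreservesDomain (A : H →ₗ.[ℂ] H) (K : H →L[ℂ] H) : Prop :=
  ∀ u ∈ A.domain, (K : H →ₗ[ℂ] H) u ∈ A.domain

/-- The commutator `[K, X] = K X - X K` on `Dom A`, for `X : Dom A → H` and a bounded operator `K`
that maps `Dom A` into itself. -/
def commutatorOn (A : H →ₗ.[ℂ] H) (K : H →L[ℂ] H) (hK : PreservesDomain A K)
    (X : A.domain →ₗ[ℂ] H) : A.domain →ₗ[ℂ] H :=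
  (K : H →ₗ[ℂ] H) ∘ₗ X - X ∘ₗ (K : H →ₗ[ℂ] H).restrict hK

/-- `K` maps `Dom A` into itself, and `[K, [K, A]]`, defined on `Dom A`, extends to a bounded
operator of norm at most `γ`. -/
def DoubleCommutatorBoundedBy (A : H →ₗ.[ℂ] H) (K : H →L[ℂ] H) (γ : ℝ) : Prop :=
  ∃ hK : PreservesDomain A K, ∃ B : H →L[ℂ] H, ‖B‖ ≤ γ ∧
    ∀ u : A.domain, B u = commutatorOn A K hK (commutatorOn A K hK A.toFun) u

variable [CompleteSpace H]

/-- The operator `f(A)` for self-adjoint `A` and a function `f` that is continuous on the spectrum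
of `A` and tends to `0` at infinity along it. It is obtained from the continuous functional calculus
of the bounded normal operator `R = (A + i)⁻¹`: under `w = (x + i)⁻¹` the spectrum of `A` corresponds
to the nonzero part of the spectrum of `R`, with `x = Re (w⁻¹)`, and `x = ∞` to `w = 0`. -/
def functionOf (A : H →ₗ.[ℂ] H) (f : ℝ → ℂ) : H →L[ℂ] H :=
  cfc (fun w : ℂ => if w = 0 then 0 else f (w⁻¹).re) (resolventOp A (-Complex.I))

/-- The heat operator `e^{-tA}`, for `t > 0` and `A` self-adjoint and bounded below. -/
def heatOperator (A : H →ₗ.[ℂ] H) (t : ℝ) : H →L[ℂ] H :=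
  functionOf A (fun x => (Real.exp (-t * x) : ℂ))

/-- The spectral subspace of the self-adjoint operator `A` for the closed half-line `(-∞, r]`:
the vectors annihilated by `f(A)` for every `f ∈ C₀(ℝ)` that vanishes on `(-∞, r]`. Its orthogonal
complement is the closed span of the ranges of these `f(A)`, the spectral subspace
for `(r, ∞)`. -/
def spectralSubspace (A : H →ₗ.[ℂ] H) (r : ℝ) : Submodule ℂ H :=
  ⨅ f : {f : C₀(ℝ, ℂ) // ∀ x ≤ r, f x = 0}, (functionOf A f.1).ker

theorem isClosed_spectralSubspace (A : H →ₗ.[ℂ] H) (r : ℝ) :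
    IsClosed (spectralSubspace A r : Set H) := by
  rw [spectralSubspace, Submodule.coe_iInf]
  exact isClosed_iInter fun f => (functionOf A f.1).isClosed_ker

instance (A : H →ₗ.[ℂ] H) (r : ℝ) : CompleteSpace (spectralSubspace A r) :=
  (isClosed_spectralSubspace A r).completeSpace_coe

/-- The spectral projection `E(r) = χ_{(-∞, r]}(A)` of the self-adjoint operator `A`. -/
def spectralProjection (A : H →ₗ.[ℂ] H) (r : ℝ) : H →L[ℂ] H :=
  (spectralSubspace A r).starProjection

end Unbounded

/-! ### Bicommutants, traces, equivalence of projections -/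

section Operators

variable {H : Type*} [NormedAddCommGroup H] [InnerProductSpace ℂ H] [CompleteSpace H]

/-- The von Neumann algebra `B''`. -/
def bicommutant (B : NonUnitalStarSubalgebra ℂ (H →L[ℂ] H)) : VonNeumannAlgebra H where
  toStarSubalgebra := StarSubalgebra.centralizer ℂ (Set.centralizer (B : Set (H →L[ℂ] H)))
  centralizer_centralizer' := by
    have h : star (Set.centralizer (B : Set (H →L[ℂ] H))) ⊆
        Set.centralizer (B : Set (H →L[ℂ] H)) := by
      intro x hx b hb
      have := hx (star b) (star_mem hb)
      simpa using (congrArg star this).symm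
    simp [Set.union_eq_self_of_subset_right h]

/-- `B''` is the bicommutant of the set `B`. -/
theorem coe_bicommutant (B : NonUnitalStarSubalgebra ℂ (H →L[ℂ] H)) :
    (bicommutant B : Set (H →L[ℂ] H)) =
      Set.centralizer (Set.centralizer (B : Set (H →L[ℂ] H))) := by
  rw [← VonNeumannAlgebra.centralizer_centralizer]
  have h : star (Set.centralizer (B : Set (H →L[ℂ] H))) ⊆
      Set.centralizer (B : Set (H →L[ℂ] H)) := by
    intro x hx b hb
    have := hx (star b) (star_mem hb)
    simpa using (congrArg star this).symm
  have h' : (bicommutant B : Set (H →L[ℂ] H)) =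
      (StarSubalgebra.centralizer ℂ (Set.centralizer (B : Set (H →L[ℂ] H))) :
        Set (H →L[ℂ] H)) := rfl
  rw [h']
  simp [Set.union_eq_self_of_subset_right h]

/-- `τ` is a faithful, normal, semi-finite trace on the von Neumann algebra `M`. Only the values
of `τ` on the positive elements of `M` matter. -/
structure IsFaithfulNormalSemifiniteTrace (M : VonNeumannAlgebra H)
    (τ : (H →L[ℂ] H) → ℝ≥0∞) : Prop where
  add : ∀ x ∈ M, ∀ y ∈ M, 0 ≤ x → 0 ≤ y → τ (x + y) = τ x + τ y
  smul : ∀ (c : ℝ≥0), ∀ x ∈ M, 0 ≤ x → τ (((c : ℝ) : ℂ) • x) = c * τ x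
  tracial : ∀ x ∈ M, τ (star x * x) = τ (x * star x)
  faithful : ∀ x ∈ M, 0 ≤ x → τ x = 0 → x = 0
  normal : ∀ (D : Set (H →L[ℂ] H)) (x : H →L[ℂ] H), D.Nonempty → (∀ d ∈ D, d ∈ M ∧ 0 ≤ d) →
    DirectedOn (· ≤ ·) D → x ∈ M → IsLUB D x → τ x = ⨆ d ∈ D, τ d
  semifinite : ∀ x ∈ M, 0 ≤ x → x ≠ 0 → ∃ y ∈ M, 0 ≤ y ∧ y ≤ x ∧ y ≠ 0 ∧ τ y < ∞

/-- `P` and `Q` are self-adjoint projections in `B` that are Murray-von Neumann equivalent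
in `B`. -/
def MurrayVonNeumannEquivalentIn (B : NonUnitalStarSubalgebra ℂ (H →L[ℂ] H))
    (P Q : H →L[ℂ] H) : Prop :=
  (P ∈ B ∧ IsStarProjection P) ∧ (Q ∈ B ∧ IsStarProjection Q) ∧
    ∃ v ∈ B, star v * v = P ∧ v * star v = Q

end Operators

/-! ### Holomorphic functional calculus and smooth subalgebras -/

section Smooth

/-- The integral `∫_Γ F(z) dz` over the chain `Γ` of curves `γ j : [0, 1] → ℂ`. -/
def contourIntegral {E : Type*} [NormedAddCommGroup E] [NormedSpace ℂ E] {n : ℕ}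
    (γ : Fin n → ℝ → ℂ) (F : ℂ → E) : E :=
  ∑ j, ∫ t in (0 : ℝ)..1, deriv (γ j) t • F (γ j t)

/-- `γ` is a finite family of closed `C¹` curves in `U \ K` that surrounds `K` once within `U`:
the total winding number is `1` around the points of `K` and `0` around the points
outside `U`. -/
structure SurroundsWithin {n : ℕ} (γ : Fin n → ℝ → ℂ) (K U : Set ℂ) : Prop where
  contDiff : ∀ j, ContDiff ℝ 1 (γ j)
  closed : ∀ j, γ j 0 = γ j 1
  mem : ∀ j, ∀ t ∈ Set.Icc (0 : ℝ) 1, γ j t ∈ U \ K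
  winding_inside : ∀ w ∈ K,
    (2 * Real.pi * Complex.I : ℂ)⁻¹ * contourIntegral γ (fun z => (z - w)⁻¹) = 1
  winding_outside : ∀ w ∉ U,
    (2 * Real.pi * Complex.I : ℂ)⁻¹ * contourIntegral γ (fun z => (z - w)⁻¹) = 0

variable {𝔄 : Type*} [NonUnitalCStarAlgebra 𝔄]

/-- `b = f(a) = (2πi)⁻¹ ∫_Γ f(z) (z - a)⁻¹ dz`, where `f` is holomorphic in the open neighbourhood
`U` of the spectrum of `a` and `Γ` surrounds the spectrum of `a` within `U`. -/
def IsHolomorphicFunctionOf (f : ℂ → ℂ) (a b : Unitization ℂ 𝔄) : Prop :=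
  ∃ U : Set ℂ, IsOpen U ∧ spectrum ℂ a ⊆ U ∧ DifferentiableOn ℂ f U ∧
    ∃ (n : ℕ) (γ : Fin n → ℝ → ℂ), SurroundsWithin γ (spectrum ℂ a) U ∧
      b = (2 * Real.pi * Complex.I : ℂ)⁻¹ • contourIntegral γ (fun z => f z • resolvent a z)

/-- A smooth subalgebra: a dense `*`-subalgebra `𝔄₀` of `𝔄` such that the algebra obtained by
adjoining a unit to `𝔄₀`, i.e. the set of the `a + c` with `a ∈ 𝔄₀` and `c ∈ ℂ`, is stable under the
holomorphic functional calculus of the unitization of `𝔄`. -/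
structure IsSmoothSubalgebra (𝔄₀ : NonUnitalStarSubalgebra ℂ 𝔄) : Prop where
  dense : Dense (𝔄₀ : Set 𝔄)
  holomorphic_stable : ∀ a : Unitization ℂ 𝔄, a.snd ∈ 𝔄₀ →
    ∀ (f : ℂ → ℂ) (b : Unitization ℂ 𝔄), IsHolomorphicFunctionOf f a b → b.snd ∈ 𝔄₀

end Smooth

end SpectralEquiv

end

open SpectralEquiv

/-! Let `P` and `Q s` be the transported spectral projections of `A₁` at `r₁` and of `A₂` at `s`.
The gap gives `(A₁ u, u) ≤ a₁ ‖u‖²` on the range of `E₁(r₁)`. The localization formula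
(`localization_bound`) then shows that `J₁ u` keeps a fixed share of the norm of `u` and has form at
most `(a₁ + γ₁) ‖J₁ u‖²`. The map `B = i₂ J p₁` satisfies `B* B = J₁²`, so `‖B u‖ = ‖J₁ u‖`, and
comparing the forms bounds that of `A₂` at `B u` by `a₂ ‖B u‖²`. Hence for `s > a₂` the projection
`E₂(s)` cannot shrink `B u` below a fixed multiple of `‖u‖`
(`exists_lower_bound_spectralProjection`). The same argument runs back from `E₂(s)` to `E₁(r₁)` when
`s < b₂`.

Polar decomposition (`star_mul_self_polar`) turns the two lower bounds into partial isometries in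
the von Neumann algebra, so `τ (Q s) = τ P` for all `s` in `(a₂, b₂)`. This trace is finite because
`e^{-r} E(r) ≤ e^{-A}`. As `τ` is faithful and `Q s` increases with `s`, the family `Q s` is
constant, i.e. `A₂` has no spectrum in `(a₂, b₂)`. Both projections are then holomorphic functions
of heat operators and lie in `π(𝔄₀)`.

For the equivalence inside `π(𝔄₀)`, the intertwiner `Q W P` belongs to `π(𝔄)`. Approximating it from
the dense `𝔄₀` keeps it bounded below on the range of `P`, and its polar part is again given by a
holomorphic function. That part maps the range of `P` isometrically into that of `Q`; equal finite
traces make the map onto (`murrayVonNeumannEquivalentIn_of_lower_bound`). -/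

namespace SpectralEquiv

/-! ### The resolvent `R = (A + i)⁻¹` of a self-adjoint operator -/

section SelfAdjointOperators

open Complex

variable {H : Type*} [NormedAddCommGroup H] [InnerProductSpace ℂ H] [CompleteSpace H]
  {A : H →ₗ.[ℂ] H}

theorem inner_map_eq (hA : IsSelfAdjoint A) (u v : A.domain) : ⟪A u, (v : H)⟫_ℂ = ⟪(u : H), A v⟫_ℂ := by
  have h : A.adjoint.IsFormalAdjoint A := LinearPMap.adjoint_isFormalAdjoint hA.dense_domain
  rw [LinearPMap.isSelfAdjoint_def.1 hA] at h
  exact h u v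

/-- The form of `A` is real, so for purely imaginary `z` the cross term vanishes. -/
theorem norm_sub_smul_sq (hA : IsSelfAdjoint A) {z : ℂ} (hz : z.re = 0) (u : A.domain) :
    ‖A u - z • (u : H)‖ ^ 2 = ‖A u‖ ^ 2 + ‖z‖ ^ 2 * ‖(u : H)‖ ^ 2 := by
  have hreal : (⟪A u, (u : H)⟫_ℂ).im = 0 := by
    have h := inner_map_eq hA u u
    rw [← inner_conj_symm] at h
    exact Complex.conj_eq_iff_im.1 (by rw [inner_conj_symm]; rw [← h, inner_conj_symm])
  rw [norm_sub_sq (𝕜 := ℂ), inner_smul_right, norm_smul]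
  have : RCLike.re (z * ⟪A u, (u : H)⟫_ℂ) = 0 := by
    change (z * ⟪A u, (u : H)⟫_ℂ).re = 0
    rw [Complex.mul_re, hz, hreal]; ring
  rw [this]; ring

/-- On the graph of `A`, complete because `A` is closed, `A - z` is bounded below, hence injective
with closed range. A vector orthogonal to the range is an eigenvector of `A* = A` for the conjugate
of `z`, and the same norm identity forces it to vanish. -/
theorem exists_isResolventAt (hA : IsSelfAdjoint A) {z : ℂ} (hz : z.re = 0) (hz1 : ‖z‖ = 1) :
    ∃ R : H →L[ℂ] H, IsResolventAt A z R := by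
  have hcl : IsClosed (A.graph : Set (H × H)) := hA.isClosed
  have : CompleteSpace A.graph := hcl.completeSpace_coe
  let T : A.graph →L[ℂ] H :=
    (ContinuousLinearMap.snd ℂ H H - z • ContinuousLinearMap.fst ℂ H H) ∘L A.graph.subtypeL
  have hT : ∀ p : A.graph, ‖p‖ ≤ ‖T p‖ := by
    rintro ⟨⟨x, y⟩, hp⟩
    obtain ⟨u, rfl, rfl⟩ := (LinearPMap.mem_graph_iff A).1 hp
    have h := norm_sub_smul_sq hA hz u
    rw [hz1] at h
    change max ‖(u : H)‖ ‖A u‖ ≤ ‖A u - z • (u : H)‖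
    refine max_le ?_ ?_ <;> refine (sq_le_sq₀ (norm_nonneg _) (norm_nonneg _)).1 ?_ <;> nlinarith [sq_nonneg ‖(u : H)‖, sq_nonneg ‖A u‖]
  have hanti : AntilipschitzWith 1 T :=
    AddMonoidHomClass.antilipschitz_of_bound T (fun p => by simpa using hT p)
  have hclosed : IsClosed (T.range : Set H) := by
    have := hanti.isClosed_range T.uniformContinuous
    rw [LinearMap.coe_range]; exact this
  have : CompleteSpace T.range := hclosed.completeSpace_coe
  have htop : T.range = ⊤ := by
    rw [← Submodule.orthogonal_eq_bot_iff, Submodule.eq_bot_iff]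
    intro v hv
    have h1 : ∀ x : A.domain, ⟪(starRingEnd ℂ) z • v, (x : H)⟫_ℂ = ⟪v, A x⟫_ℂ := by
      intro x
      have hx : ⟪A x - z • (x : H), v⟫_ℂ = 0 :=
        (Submodule.mem_orthogonal _ _).1 hv _ ⟨⟨((x : H), A x), LinearPMap.mem_graph A x⟩, rfl⟩
      have hx' : ⟪v, A x - z • (x : H)⟫_ℂ = 0 := by rw [← inner_conj_symm, hx, map_zero]
      rw [inner_sub_right, inner_smul_right, sub_eq_zero] at hx'
      rw [inner_smul_left, hx']; simp
    have hmem : v ∈ A.adjoint.domain := LinearPMap.mem_adjoint_domain_of_exists v ⟨_, h1⟩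
    have hval : A.adjoint ⟨v, hmem⟩ = (starRingEnd ℂ) z • v :=
      LinearPMap.adjoint_apply_eq hA.dense_domain ⟨v, hmem⟩ h1
    have hAA : A.adjoint = A := hA
    have key : ∀ (B : H →ₗ.[ℂ] H), B = A → ∀ (h : v ∈ B.domain), B ⟨v, h⟩ = (starRingEnd ℂ) z • v →
        v = 0 := by
      rintro B rfl h hB
      have := norm_sub_smul_sq hA (z := (starRingEnd ℂ) z) (by simpa using hz) ⟨v, h⟩
      rw [hB, sub_self, norm_zero, RCLike.norm_conj, hz1] at this
      have h0 : ‖v‖ ^ 2 = 0 := by nlinarith [sq_nonneg ‖v‖, sq_nonneg ‖(starRingEnd ℂ) z • v‖]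
      simpa using h0
    exact key _ hAA hmem hval
  let e : A.graph ≃ₗ[ℂ] H := LinearEquiv.ofBijective (T : A.graph →ₗ[ℂ] H)
    ⟨hanti.injective, LinearMap.range_eq_top.1 htop⟩
  have he : ∀ v, T (e.symm v) = v := fun v => e.apply_symm_apply v
  let R : H →L[ℂ] H := LinearMap.mkContinuous
    (LinearMap.fst ℂ H H ∘ₗ A.graph.subtype ∘ₗ (e.symm : H →ₗ[ℂ] A.graph)) 1 (fun v => by
      have h1 := hT (e.symm v)
      rw [he] at h1
      rw [one_mul]
      exact (norm_fst_le (e.symm v : H × H)).trans h1)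
  have hR : ∀ v, R v = (e.symm v : H × H).1 := fun v => rfl
  refine ⟨R, fun v => ?_, fun u => ?_⟩
  · obtain ⟨u, h1, h2⟩ := (LinearPMap.mem_graph_iff A).1 (e.symm v).2
    have h3 : (e.symm v : H × H).2 - z • (e.symm v : H × H).1 = v := he v
    rw [← h2, ← h1] at h3
    have h4 : R v = u := by rw [hR, h1]
    refine ⟨h4 ▸ u.2, ?_⟩
    have h5 : (⟨R v, h4 ▸ u.2⟩ : A.domain) = u := Subtype.ext h4
    rw [h5, h4, h3]
  · have : e.symm (A u - z • (u : H)) = ⟨((u : H), A u), LinearPMap.mem_graph A u⟩ := by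
      rw [LinearEquiv.symm_apply_eq]; rfl
    rw [hR, this]

theorem isResolventAt_resolventOp (hA : IsSelfAdjoint A) : IsResolventAt A (-I) (resolventOp A (-I)) := by
  have h := exists_isResolventAt hA (z := -I) (by simp) (by simp)
  rw [resolventOp, dif_pos h]
  exact h.choose_spec

theorem resolvent_mem_domain (hA : IsSelfAdjoint A) (v : H) : resolventOp A (-I) v ∈ A.domain :=
  ((isResolventAt_resolventOp hA).1 v).1

theorem map_resolvent (hA : IsSelfAdjoint A) (v : H) :
    A ⟨resolventOp A (-I) v, resolvent_mem_domain hA v⟩ = v - I • resolventOp A (-I) v := by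
  obtain ⟨h, h1⟩ := (isResolventAt_resolventOp hA).1 v
  rw [neg_smul, sub_neg_eq_add] at h1
  exact eq_sub_of_add_eq h1

theorem resolvent_map_add (hA : IsSelfAdjoint A) (u : A.domain) :
    resolventOp A (-I) (A u + I • (u : H)) = u := by
  have := (isResolventAt_resolventOp hA).2 u
  rwa [neg_smul, sub_neg_eq_add] at this

theorem resolvent_injective (hA : IsSelfAdjoint A) {v : H} (hv : resolventOp A (-I) v = 0) : v = 0 := by
  have h := map_resolvent hA v
  have h0 : (⟨resolventOp A (-I) v, resolvent_mem_domain hA v⟩ : A.domain) = 0 := Subtype.ext hv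
  rw [h0, hv, LinearPMap.map_zero, smul_zero, sub_zero] at h
  exact h.symm

/-- Adjoint of `(A + i) R = 1`: `R*` is a left inverse of `A - i`. -/
theorem adjoint_resolvent_add (hA : IsSelfAdjoint A) (u : A.domain) :
    star (resolventOp A (-I)) (A u - I • (u : H)) = u := by
  refine ext_inner_left ℂ fun v => ?_
  rw [ContinuousLinearMap.star_eq_adjoint, ContinuousLinearMap.adjoint_inner_right]
  have h := inner_map_eq hA ⟨resolventOp A (-I) v, resolvent_mem_domain hA v⟩ u
  rw [map_resolvent hA] at h
  simp only [inner_sub_left, inner_smul_left, conj_I] at h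
  rw [inner_sub_right, inner_smul_right]
  linear_combination -h

/-- The identity `R - R* = -2i R* R`. -/
theorem resolvent_sub_star (hA : IsSelfAdjoint A) :
    resolventOp A (-I) - star (resolventOp A (-I)) =
      -(2 * I) • (star (resolventOp A (-I)) * resolventOp A (-I)) := by
  ext v
  -- At `u = R v` one has `(A - i) u = v - 2i R v`.
  have h := adjoint_resolvent_add hA ⟨resolventOp A (-I) v, resolvent_mem_domain hA v⟩
  rw [map_resolvent hA] at h
  simp only [map_sub, map_smul] at h
  simp only [sub_apply, smul_apply, mul_apply_eq_comp]
  linear_combination (norm := module) (-1 : ℂ) • h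

/-- The identity `R - R* = -2i R R*`. -/
theorem resolvent_sub_star' (hA : IsSelfAdjoint A) :
    resolventOp A (-I) - star (resolventOp A (-I)) =
      -(2 * I) • (resolventOp A (-I) * star (resolventOp A (-I))) := by
  -- The opposite order of factors needs `R*` as a right inverse of `A - i` too, so it is identified
  -- with the true resolvent `S` at `i`.
  have hex := exists_isResolventAt hA (z := I) (by simp) (by simp)
  obtain ⟨S, hS⟩ := hex
  have hstar : star (resolventOp A (-I)) = S := by
    ext v
    obtain ⟨h, hv⟩ := hS.1 v
    have := adjoint_resolvent_add hA ⟨S v, h⟩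
    simp only at this hv
    rwa [hv] at this
  rw [hstar]
  ext v
  obtain ⟨h, hv⟩ := hS.1 v
  have h2 := resolvent_map_add hA ⟨S v, h⟩
  have h3 : A ⟨S v, h⟩ = v + I • S v := eq_add_of_sub_eq hv
  rw [h3] at h2
  simp only [map_add, map_smul] at h2
  simp only [sub_apply, smul_apply, mul_apply_eq_comp]
  linear_combination (norm := module) h2

theorem isStarNormal_resolvent (hA : IsSelfAdjoint A) : IsStarNormal (resolventOp A (-I)) := by
  refine ⟨?_⟩
  have h := (resolvent_sub_star hA).symm.trans (resolvent_sub_star' hA)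
  have h2 : (-(2 * I) : ℂ) ≠ 0 := by simp
  exact smul_right_injective _ h2 h

end SelfAdjointOperators

/-! ### Functional calculus of `A` through the spectrum of its resolvent -/

section Calculus

open Complex Filter Topology

variable {H : Type*} [NormedAddCommGroup H] [InnerProductSpace ℂ H] [CompleteSpace H]
  {A : H →ₗ.[ℂ] H} {l : ℝ}

/-- Continuous functions that tend to `0` at `+∞`. -/
structure VanishesAtTop (f : ℝ → ℂ) : Prop where
  continuous : Continuous f
  tendsto : Tendsto f atTop (𝓝 0)

/-- The resolvent variable `w = (x + i)⁻¹` belongs to the spectrum of the resolvent. -/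
def InSpectrum (A : H →ₗ.[ℂ] H) (x : ℝ) : Prop :=
  ((x : ℂ) + I)⁻¹ ∈ spectrum ℂ (resolventOp A (-I))

theorem add_I_ne_zero (x : ℝ) : (x : ℂ) + I ≠ 0 := by
  intro h; simpa using congrArg Complex.im h

/-- The identity `R - R* = -2i R* R` descends to the spectrum as `w - w̄ = -2i |w|²`, a circle
through `0`; after inversion it is the line `Im = 1`. -/
theorem inv_im_of_mem_spectrum (hA : IsSelfAdjoint A) {w : ℂ}
    (hw : w ∈ spectrum ℂ (resolventOp A (-I))) (h0 : w ≠ 0) : w⁻¹ = ((w⁻¹).re : ℂ) + I := by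
  have hn := isStarNormal_resolvent hA
  have hid := cfc_id' ℂ (resolventOp A (-I))
  have hst := cfc_star_id (R := ℂ) (resolventOp A (-I))
  have h1 : cfc (fun w : ℂ => w - star w) (resolventOp A (-I)) =
      cfc (fun w : ℂ => -(2 * I) * (star w * w)) (resolventOp A (-I)) := by
    rw [cfc_sub (fun w : ℂ => w) (fun w : ℂ => star w) (resolventOp A (-I)),
      cfc_const_mul (-(2 * I)) (fun w : ℂ => star w * w) (resolventOp A (-I)),
      cfc_mul (fun w : ℂ => star w) (fun w : ℂ => w) (resolventOp A (-I)), hid, hst,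
      resolvent_sub_star hA]
  have h2 := (cfc_eq_cfc_iff_eqOn (R := ℂ) hn (by fun_prop) (by fun_prop)).1 h1 hw
  simp only [RCLike.star_def] at h2
  have h3 : (starRingEnd ℂ) w ≠ 0 := by simpa using h0
  have h4 : w⁻¹ - (starRingEnd ℂ) w⁻¹ = 2 * I := by
    rw [map_inv₀]; field_simp; linear_combination -h2
  have h5 := congrArg Complex.im h4
  have h6 : (2 * I).im = 2 := by simp
  rw [sub_im, conj_im, h6] at h5
  apply Complex.ext
  · simp
  · rw [add_im, ofReal_im, I_im]; linarith

/-- With `u = R v` the form of this bounded operator at `v` is `(A u, u) - l ‖u‖²`. -/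
theorem resolvent_lower_bound (hA : IsSelfAdjoint A) (hl : IsBoundedBelowBy A l) :
    0 ≤ star (resolventOp A (-I)) -
      (l + I : ℂ) • (star (resolventOp A (-I)) * resolventOp A (-I)) := by
  rw [ContinuousLinearMap.nonneg_iff_isPositive, ContinuousLinearMap.isPositive_iff_complex]
  intro v
  set u : A.domain := ⟨resolventOp A (-I) v, resolvent_mem_domain hA v⟩ with hu
  have h1 : ⟪(star (resolventOp A (-I)) -
      (l + I : ℂ) • (star (resolventOp A (-I)) * resolventOp A (-I))) v, v⟫_ℂ =
      ⟪A u, (u : H)⟫_ℂ - l * ‖(u : H)‖ ^ 2 := by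
    rw [hu, map_resolvent hA]
    simp only [sub_apply, smul_apply, mul_apply_eq_comp, inner_sub_left, inner_smul_left,
      ContinuousLinearMap.star_eq_adjoint, ContinuousLinearMap.adjoint_inner_left]
    rw [inner_self_eq_norm_sq_to_K]
    simp
    ring
  have h2 : (⟪A u, (u : H)⟫_ℂ).im = 0 := by
    have h := inner_map_eq hA u u
    rw [← inner_conj_symm] at h
    exact Complex.conj_eq_iff_im.1 (by rw [inner_conj_symm]; rw [← h, inner_conj_symm])
  rw [h1]
  have h3 := hl u
  constructor
  · apply Complex.ext
    · simp
    · simp [h2, ← ofReal_pow]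
  · simp only [RCLike.re_eq_complex_re, sub_re, ← ofReal_pow, ← ofReal_mul, ofReal_re]
    linarith

open scoped ComplexOrder in
-- On the spectrum the positive operator of `resolvent_lower_bound` takes the value `|w|² (Re w⁻¹ -
-- l)`.
theorem le_of_mem_spectrum (hA : IsSelfAdjoint A) (hl : IsBoundedBelowBy A l) {w : ℂ}
    (hw : w ∈ spectrum ℂ (resolventOp A (-I))) (h0 : w ≠ 0) : l ≤ (w⁻¹).re := by
  have hn := isStarNormal_resolvent hA
  have hid := cfc_id' ℂ (resolventOp A (-I))
  have hst := cfc_star_id (R := ℂ) (resolventOp A (-I))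
  have h1 : cfc (fun w : ℂ => star w - (l + I) * (star w * w)) (resolventOp A (-I)) =
      star (resolventOp A (-I)) -
      (l + I : ℂ) • (star (resolventOp A (-I)) * resolventOp A (-I)) := by
    rw [cfc_sub (fun w : ℂ => star w) (fun w : ℂ => (l + I) * (star w * w)) (resolventOp A (-I)),
      cfc_const_mul (l + I : ℂ) (fun w : ℂ => star w * w) (resolventOp A (-I)),
      cfc_mul (fun w : ℂ => star w) (fun w : ℂ => w) (resolventOp A (-I)), hid, hst]
  have h2 := resolvent_lower_bound hA hl
  rw [← h1] at h2
  have h3 := (cfc_nonneg_iff _ _ (by fun_prop) hn).1 h2 w hw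
  have h4 : star w - (l + I) * (star w * w) = ((‖w‖ ^ 2 * ((w⁻¹).re - l) : ℝ) : ℂ) := by
    have h5 := inv_im_of_mem_spectrum hA hw h0
    have h6 : star w * w = ((‖w‖ ^ 2 : ℝ) : ℂ) := by
      rw [RCLike.star_def, mul_comm, mul_conj, normSq_eq_norm_sq]
    have h7 : star w = star w * w * w⁻¹ := by field_simp
    rw [h7, h6]
    generalize (w⁻¹).re = x at h5 ⊢
    rw [h5] at h7 ⊢
    have h8 : (x + I : ℂ) * w = 1 := by rw [← h5]; field_simp
    push_cast
    linear_combination (-(l + I : ℂ) * ‖w‖ ^ 2 ) * h8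
  have h5 : (0 : ℝ) ≤ ‖w‖ ^ 2 * ((w⁻¹).re - l) := by
    simp only [h4] at h3; exact_mod_cast h3
  have h6 : 0 < ‖w‖ ^ 2 := by positivity
  nlinarith [nonneg_of_mul_nonneg_right h5 h6]

theorem mem_spectrum_cases (hA : IsSelfAdjoint A) (hl : IsBoundedBelowBy A l) {w : ℂ}
    (hw : w ∈ spectrum ℂ (resolventOp A (-I))) :
    w = 0 ∨ w ≠ 0 ∧ w⁻¹ = ((w⁻¹).re : ℂ) + I ∧ l ≤ (w⁻¹).re ∧ InSpectrum A (w⁻¹).re := by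
  by_cases h0 : w = 0
  · exact Or.inl h0
  · have h := inv_im_of_mem_spectrum hA hw h0
    refine Or.inr ⟨h0, h, le_of_mem_spectrum hA hl hw h0, ?_⟩
    rw [InSpectrum, ← h, inv_inv]; exact hw

/-- The function of the resolvent variable that corresponds to `f`. -/
noncomputable def transferred (f : ℝ → ℂ) (w : ℂ) : ℂ :=
  open Classical in if w = 0 then 0 else f (w⁻¹).re

theorem transferred_zero (f : ℝ → ℂ) : transferred f 0 = 0 := if_pos rfl

theorem transferred_of_ne {f : ℝ → ℂ} {w : ℂ} (hw : w ≠ 0) : transferred f w = f (w⁻¹).re :=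
  if_neg hw

theorem functionOf_def (A : H →ₗ.[ℂ] H) (f : ℝ → ℂ) :
    functionOf A f = cfc (transferred f) (resolventOp A (-I)) := by
  rw [functionOf]; congr

/-- The only delicate point is `w = 0`, the point at infinity of the spectrum of `A`. As `A` is
bounded below, it is approached only through `x → +∞`, so decay at `+∞` suffices. -/
theorem continuousOn_transferred (hA : IsSelfAdjoint A) (hl : IsBoundedBelowBy A l) {f : ℝ → ℂ}
    (hf : VanishesAtTop f) :
    ContinuousOn (transferred f) (spectrum ℂ (resolventOp A (-I))) := by
  intro w hw
  by_cases h0 : w = 0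
  · subst h0
    rw [Metric.continuousWithinAt_iff]
    intro ε hε
    obtain ⟨X, hX⟩ := eventually_atTop.1 (hf.tendsto.eventually (Metric.ball_mem_nhds 0 hε))
    -- This radius forces `|x| > |X| + |l| + 1` for `x = Re w⁻¹`; a negative `x` would lie below
    -- `l`, so `x > X`.
    refine ⟨(|X| + |l| + 2)⁻¹, by positivity, fun {w} hw hd => ?_⟩
    rcases mem_spectrum_cases hA hl hw with rfl | ⟨h0, h1, h2, -⟩
    · simpa using hε
    · rw [transferred_of_ne h0, transferred_zero]
      refine Metric.mem_ball.1 (hX _ ?_)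
      rw [dist_zero_right] at hd
      have h3 : |X| + |l| + 2 < ‖w⁻¹‖ := by
        rw [norm_inv]
        exact (lt_inv_comm₀ (by positivity) (by simpa using h0)).2 hd
      have h4 : ‖w⁻¹‖ ≤ |(w⁻¹).re| + 1 := by
        generalize (w⁻¹).re = x at h1 ⊢
        rw [h1]
        refine (norm_add_le _ _).trans ?_
        simp
      rcases le_or_gt 0 (w⁻¹).re with h5 | h5
      · rw [abs_of_nonneg h5] at h4
        linarith [le_abs_self X, abs_nonneg l]
      · rw [abs_of_neg h5] at h4
        linarith [neg_abs_le l, abs_nonneg X]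
  · have h1 : transferred f =ᶠ[𝓝 w] fun w => f (w⁻¹).re := by
      filter_upwards [isOpen_ne.mem_nhds h0] with z hz using transferred_of_ne hz
    refine (ContinuousAt.congr ?_ h1.symm).continuousWithinAt
    exact hf.continuous.continuousAt.comp (continuous_re.continuousAt.comp (continuousAt_inv₀ h0))

theorem functionOf_congr (hA : IsSelfAdjoint A) (hl : IsBoundedBelowBy A l) {f g : ℝ → ℂ}
    (h : ∀ x, l ≤ x → InSpectrum A x → f x = g x) : functionOf A f = functionOf A g := by
  rw [functionOf_def, functionOf_def]
  refine cfc_congr fun w hw => ?_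
  rcases mem_spectrum_cases hA hl hw with rfl | ⟨h0, -, h2, h3⟩
  · rw [transferred_zero, transferred_zero]
  · rw [transferred_of_ne h0, transferred_of_ne h0, h _ h2 h3]

theorem functionOf_mul (hA : IsSelfAdjoint A) (hl : IsBoundedBelowBy A l) {f g : ℝ → ℂ}
    (hf : VanishesAtTop f) (hg : VanishesAtTop g) :
    functionOf A (fun x => f x * g x) = functionOf A f * functionOf A g := by
  rw [functionOf_def, functionOf_def, functionOf_def,
    ← cfc_mul _ _ _ (continuousOn_transferred hA hl hf) (continuousOn_transferred hA hl hg)]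
  congr 1; ext w; by_cases h : w = 0 <;> simp [transferred, h]

theorem functionOf_sub (hA : IsSelfAdjoint A) (hl : IsBoundedBelowBy A l) {f g : ℝ → ℂ}
    (hf : VanishesAtTop f) (hg : VanishesAtTop g) :
    functionOf A (fun x => f x - g x) = functionOf A f - functionOf A g := by
  rw [functionOf_def, functionOf_def, functionOf_def,
    ← cfc_sub _ _ _ (continuousOn_transferred hA hl hf) (continuousOn_transferred hA hl hg)]
  congr 1; ext w; by_cases h : w = 0 <;> simp [transferred, h]

theorem functionOf_const_mul (hA : IsSelfAdjoint A) (hl : IsBoundedBelowBy A l) {f : ℝ → ℂ} (c : ℂ)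
    (hf : VanishesAtTop f) : functionOf A (fun x => c * f x) = c • functionOf A f := by
  rw [functionOf_def, functionOf_def,
    ← cfc_const_mul _ _ _ (continuousOn_transferred hA hl hf)]
  congr 1; ext w; by_cases h : w = 0 <;> simp [transferred, h]

theorem functionOf_star (A : H →ₗ.[ℂ] H) (f : ℝ → ℂ) :
    functionOf A (fun x => star (f x)) = star (functionOf A f) := by
  rw [functionOf_def, functionOf_def, ← cfc_star]
  congr 1; ext w; by_cases h : w = 0 <;> simp [transferred, h]

theorem isSelfAdjoint_functionOf (A : H →ₗ.[ℂ] H) (f : ℝ → ℝ) :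
    IsSelfAdjoint (functionOf A (fun x => (f x : ℂ))) := by
  rw [IsSelfAdjoint, ← functionOf_star]; simp

theorem functionOf_zero (A : H →ₗ.[ℂ] H) : functionOf A (fun _ => 0) = 0 := by
  have h : transferred (fun _ => 0) = fun _ => 0 := by ext w; simp [transferred]
  rw [functionOf_def, h]
  by_cases hn : IsStarNormal (resolventOp A (-I))
  · exact cfc_const_zero ℂ _
  · exact cfc_apply_of_not_predicate _ hn

theorem functionOf_eq_zero (hA : IsSelfAdjoint A) (hl : IsBoundedBelowBy A l) {f : ℝ → ℂ}
    (h : ∀ x, l ≤ x → f x = 0) : functionOf A f = 0 := by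
  rw [← functionOf_zero A]; exact functionOf_congr hA hl fun x hx _ => h x hx

open scoped ComplexOrder in
theorem functionOf_nonneg (hA : IsSelfAdjoint A) (hl : IsBoundedBelowBy A l) {f : ℝ → ℝ}
    (h : ∀ x, l ≤ x → 0 ≤ f x) : 0 ≤ functionOf A (fun x => (f x : ℂ)) := by
  rw [functionOf_def]
  refine cfc_nonneg fun w hw => ?_
  rcases mem_spectrum_cases hA hl hw with rfl | ⟨h0, -, h2, -⟩
  · rw [transferred_zero]
  · rw [transferred_of_ne h0]; exact_mod_cast h _ h2

theorem vanishesAtTop_resolvent : VanishesAtTop fun x : ℝ => ((x : ℂ) + I)⁻¹ := by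
  constructor
  · exact Continuous.inv₀ (by fun_prop) add_I_ne_zero
  · refine tendsto_inv₀_cobounded.comp ?_
    rw [← tendsto_norm_atTop_iff_cobounded]
    refine tendsto_atTop_mono (fun x => ?_) tendsto_id
    have := abs_re_le_norm ((x : ℂ) + I)
    simp at this
    exact (le_abs_self x).trans this

theorem functionOf_resolvent (hA : IsSelfAdjoint A) (hl : IsBoundedBelowBy A l) :
    functionOf A (fun x => ((x : ℂ) + I)⁻¹) = resolventOp A (-I) := by
  have hn := isStarNormal_resolvent hA
  rw [functionOf_def]
  conv_rhs => rw [← cfc_id' ℂ (resolventOp A (-I))]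
  refine cfc_congr fun w hw => ?_
  rcases mem_spectrum_cases hA hl hw with rfl | ⟨h0, h1, -, -⟩
  · rw [transferred_zero]
  · rw [transferred_of_ne h0, ← h1, inv_inv]

theorem functionOf_eq_resolvent_mul (hA : IsSelfAdjoint A) (hl : IsBoundedBelowBy A l) {f : ℝ → ℂ}
    (hf : VanishesAtTop fun x => (x + I) * f x) :
    functionOf A f = resolventOp A (-I) * functionOf A (fun x => (x + I) * f x) := by
  rw [← functionOf_resolvent hA hl, ← functionOf_mul hA hl vanishesAtTop_resolvent hf]
  congr 1; ext x
  have := add_I_ne_zero x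
  field_simp

/-- Writing `f = (x + i)⁻¹ · (x + i) f` places the range of `f(A)` in the range of `R`, which is in
`Dom A` and where `A R = 1 - i R`. -/
theorem functionOf_mem_domain (hA : IsSelfAdjoint A) (hl : IsBoundedBelowBy A l) {f : ℝ → ℂ}
    (hf : VanishesAtTop f) (hf' : VanishesAtTop fun x => x * f x) (v : H) :
    ∃ h : functionOf A f v ∈ A.domain,
      A ⟨functionOf A f v, h⟩ = functionOf A (fun x => x * f x) v := by
  have h1 : VanishesAtTop fun x : ℝ => (x + I) * f x := by
    refine ⟨by have := hf.continuous; fun_prop, ?_⟩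
    have := hf'.tendsto.add (hf.tendsto.const_mul I)
    simpa [add_mul] using this
  have h2 := functionOf_eq_resolvent_mul hA hl h1
  have h3 : functionOf A f v = resolventOp A (-I) (functionOf A (fun x => (x + I) * f x) v) := by
    nth_rw 1 [h2]; rfl
  have h4 : functionOf A (fun x : ℝ => x * f x) =
      functionOf A (fun x => (x + I) * f x) - I • functionOf A f := by
    rw [← functionOf_const_mul hA hl I hf, ← functionOf_sub hA hl h1]
    · congr 1; ext x; ring
    · refine ⟨by have := hf.continuous; fun_prop, by simpa using hf.tendsto.const_mul I⟩
  refine ⟨h3 ▸ resolvent_mem_domain hA _, ?_⟩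
  have h5 : (⟨functionOf A f v, h3 ▸ resolvent_mem_domain hA _⟩ : A.domain) =
    ⟨resolventOp A (-I) (functionOf A (fun x => (x + I) * f x) v), resolvent_mem_domain hA _⟩ :=
    Subtype.ext h3
  rw [h5, map_resolvent hA, h4, ← h3]; rfl

theorem functionOf_commute (hA : IsSelfAdjoint A) (hl : IsBoundedBelowBy A l) {f g : ℝ → ℂ}
    (hf : VanishesAtTop f) (hg : VanishesAtTop g) (v : H) :
    functionOf A f (functionOf A g v) = functionOf A g (functionOf A f v) := by
  have h : functionOf A f * functionOf A g = functionOf A g * functionOf A f := by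
    rw [← functionOf_mul hA hl hf hg, ← functionOf_mul hA hl hg hf]; simp [mul_comm]
  exact congrArg (fun T => T v) h

end Calculus

/-! ### Spectral subspaces, form bounds on them, and spectral gaps -/

section SpectralSubspaces

open Complex Filter Topology

variable {H : Type*} [NormedAddCommGroup H] [InnerProductSpace ℂ H] [CompleteSpace H]
  {A : H →ₗ.[ℂ] H} {l r s : ℝ}

theorem functionOf_apply_eq_zero {f : ℝ → ℂ} (hf : VanishesAtTop f) (hr : ∀ x ≤ r, f x = 0) {u : H}
    (hu : u ∈ spectralSubspace A r) : functionOf A f u = 0 := by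
  let g : C₀(ℝ, ℂ) := ⟨⟨f, hf.continuous⟩, by
    rw [cocompact_eq_atBot_atTop]
    refine Tendsto.sup ?_ hf.tendsto
    refine tendsto_const_nhds.congr' ?_
    filter_upwards [eventually_le_atBot r] with x hx using (hr x hx).symm⟩
  rw [spectralSubspace, Submodule.mem_iInf] at hu
  exact hu ⟨g, hr⟩

theorem mem_spectralSubspace {u : H}
    (h : ∀ f, VanishesAtTop f → (∀ x ≤ r, f x = 0) → functionOf A f u = 0) :
    u ∈ spectralSubspace A r := by
  rw [spectralSubspace, Submodule.mem_iInf]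
  rintro ⟨f, hf⟩
  refine h f ⟨f.continuous, ?_⟩ hf
  have := f.zero_at_infty'
  rw [cocompact_eq_atBot_atTop] at this
  exact this.mono_left le_sup_right

theorem spectralSubspace_mono (h : r ≤ s) : spectralSubspace A r ≤ spectralSubspace A s := fun _ hu =>
  mem_spectralSubspace fun _ hf hs => functionOf_apply_eq_zero hf (fun x hx => hs x (hx.trans h)) hu

/-- The piecewise linear function that is `1` on `(-∞, r]` and `0` on `[s, ∞)`. -/
noncomputable def cutoff (r s x : ℝ) : ℝ := max 0 (min 1 ((s - x) / (s - r)))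

theorem continuous_cutoff : Continuous (cutoff r s) := by unfold cutoff; fun_prop

theorem cutoff_of_le (h : r < s) {x : ℝ} (hx : x ≤ r) : cutoff r s x = 1 := by
  have : 1 ≤ (s - x) / (s - r) := by rw [one_le_div (by linarith)]; linarith
  rw [cutoff, min_eq_left this]; simp

theorem cutoff_of_ge (h : r < s) {x : ℝ} (hx : s ≤ x) : cutoff r s x = 0 := by
  have : (s - x) / (s - r) ≤ 0 := div_nonpos_of_nonpos_of_nonneg (by linarith) (by linarith)
  rw [cutoff]
  exact max_eq_left ((min_le_right _ _).trans this)

theorem vanishesAtTop_of_eq_zero {f : ℝ → ℂ} (hf : Continuous f) (h : ∀ x, s ≤ x → f x = 0) :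
    VanishesAtTop f := by
  refine ⟨hf, tendsto_const_nhds.congr' ?_⟩
  filter_upwards [eventually_ge_atTop s] with x hx using (h x hx).symm

theorem vanishesAtTop_mul_cutoff (h : r < s) {g : ℝ → ℂ} (hg : Continuous g) :
    VanishesAtTop fun x => g x * cutoff r s x := by
  refine vanishesAtTop_of_eq_zero (s := s) ?_ fun x hx => by simp [cutoff_of_ge h hx]
  have := continuous_cutoff (r := r) (s := s)
  fun_prop

theorem vanishesAtTop_cutoff (h : r < s) : VanishesAtTop fun x => (cutoff r s x : ℂ) := by
  simpa using vanishesAtTop_mul_cutoff h (g := fun _ => 1) continuous_const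

theorem VanishesAtTop.mul_cutoff (h : r < s) {f : ℝ → ℂ}
    (hf : VanishesAtTop f) :
    VanishesAtTop fun x => f x * cutoff r s x := vanishesAtTop_mul_cutoff h hf.continuous

theorem VanishesAtTop.sub {f g : ℝ → ℂ} (hf : VanishesAtTop f) (hg : VanishesAtTop g) :
    VanishesAtTop fun x => f x - g x :=
  ⟨hf.continuous.sub hg.continuous, by simpa using hf.tendsto.sub hg.tendsto⟩

/-- The function `1 - cutoff` does not decay at `+∞`, so it is multiplied by `(x + i)⁻¹`. The
product kills `u`, and the extra factor is removed by injectivity of `R`. -/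
theorem functionOf_cutoff_apply (hA : IsSelfAdjoint A) (hl : IsBoundedBelowBy A l) (h : r < s) {u : H}
    (hu : u ∈ spectralSubspace A r) : functionOf A (fun x => (cutoff r s x : ℂ)) u = u := by
  have h1 : functionOf A (fun x : ℝ => ((x : ℂ) + I)⁻¹ - ((x : ℂ) + I)⁻¹ * cutoff r s x) u = 0 := by
    refine functionOf_apply_eq_zero (vanishesAtTop_resolvent.sub
      (vanishesAtTop_resolvent.mul_cutoff h)) (fun x hx => ?_) hu
    rw [cutoff_of_le h hx]; simp
  rw [functionOf_sub hA hl vanishesAtTop_resolvent (vanishesAtTop_resolvent.mul_cutoff h),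
    functionOf_mul hA hl vanishesAtTop_resolvent (vanishesAtTop_cutoff h),
    functionOf_resolvent hA hl] at h1
  have h2 : resolventOp A (-I) (u - functionOf A (fun x => (cutoff r s x : ℂ)) u) = 0 := by
    rw [_root_.map_sub]; exact h1
  exact (sub_eq_zero.1 (resolvent_injective hA h2)).symm

theorem functionOf_mem_spectralSubspace (hA : IsSelfAdjoint A) (hl : IsBoundedBelowBy A l) {f : ℝ → ℂ}
    (hf : VanishesAtTop f) {u : H} (hu : u ∈ spectralSubspace A r) :
    functionOf A f u ∈ spectralSubspace A r :=
  mem_spectralSubspace fun g hg hr => by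
    rw [functionOf_commute hA hl hg hf, functionOf_apply_eq_zero hg hr hu, _root_.map_zero]

theorem re_inner_functionOf_nonneg (hA : IsSelfAdjoint A) (hl : IsBoundedBelowBy A l) {f : ℝ → ℝ}
    (h : ∀ x, l ≤ x → 0 ≤ f x) (u : H) :
    0 ≤ (⟪functionOf A (fun x => (f x : ℂ)) u, u⟫_ℂ).re := by
  have h1 := functionOf_nonneg hA hl h
  rw [ContinuousLinearMap.nonneg_iff_isPositive] at h1
  exact h1.re_inner_nonneg_left u

theorem VanishesAtTop.max_zero {f : ℝ → ℝ} (hf : VanishesAtTop fun x => (f x : ℂ)) :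
    VanishesAtTop fun x => ((max (f x) 0 : ℝ) : ℂ) := by
  have hc : Continuous f := by
    have := continuous_re.comp hf.continuous
    simpa [Function.comp_def] using this
  have ht : Tendsto f atTop (𝓝 0) := by
    have := (continuous_re.tendsto 0).comp hf.tendsto
    simpa [Function.comp_def] using this
  refine ⟨by fun_prop, ?_⟩
  have := (continuous_ofReal.tendsto _).comp (ht.max (tendsto_const_nhds (x := (0 : ℝ))))
  simpa [Function.comp_def] using this

theorem VanishesAtTop.neg {f : ℝ → ℝ} (hf : VanishesAtTop fun x => (f x : ℂ)) :
    VanishesAtTop fun x => ((-f x : ℝ) : ℂ) := by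
  refine ⟨?_, ?_⟩
  · simp only [ofReal_neg]; exact hf.continuous.neg
  · simpa using hf.tendsto.neg

theorem functionOf_eq_posPart_sub (hA : IsSelfAdjoint A) (hl : IsBoundedBelowBy A l) {f : ℝ → ℝ}
    (hf : VanishesAtTop fun x => (f x : ℂ)) : functionOf A (fun x => (f x : ℂ)) =
      functionOf A (fun x => ((max (f x) 0 : ℝ) : ℂ)) -
        functionOf A (fun x => ((max (-f x) 0 : ℝ) : ℂ)) := by
  rw [← functionOf_sub hA hl hf.max_zero hf.neg.max_zero]
  congr 1; ext x
  rw [← ofReal_sub]; congr 1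
  rcases le_total 0 (f x) with h | h
  · rw [max_eq_left h, max_eq_right (by linarith)]; ring
  · rw [max_eq_right h, max_eq_left (by linarith)]; ring

/-- The negative part of `f` vanishes on `(-∞, r]` and therefore kills `u`. -/
theorem re_inner_functionOf_nonneg_of_mem (hA : IsSelfAdjoint A) (hl : IsBoundedBelowBy A l)
    {f : ℝ → ℝ} (hf : VanishesAtTop fun x => (f x : ℂ)) (h : ∀ x ≤ r, 0 ≤ f x) {u : H}
    (hu : u ∈ spectralSubspace A r) :
    0 ≤ (⟪functionOf A (fun x => (f x : ℂ)) u, u⟫_ℂ).re := by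
  have h2 : functionOf A (fun x => ((max (-f x) 0 : ℝ) : ℂ)) u = 0 :=
    functionOf_apply_eq_zero hf.neg.max_zero (fun x hx => by simp [h x hx]) hu
  rw [functionOf_eq_posPart_sub hA hl hf, sub_apply, h2, sub_zero]
  exact re_inner_functionOf_nonneg hA hl (fun x _ => le_max_right _ _) u

/-- The range of `f(A)*` lies in the spectral subspace, because `g · f̄ = 0` for every `g` vanishing
on `(-∞, r]`; `w` is orthogonal to it. -/
theorem functionOf_apply_eq_zero_of_mem_orthogonal (hA : IsSelfAdjoint A) (hl : IsBoundedBelowBy A l)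
    {f : ℝ → ℂ} (hf : Continuous f) (hr : ∀ x, r ≤ x → f x = 0) {w : H}
    (hw : w ∈ (spectralSubspace A r)ᗮ) : functionOf A f w = 0 := by
  have hfs : VanishesAtTop fun x => star (f x) :=
    vanishesAtTop_of_eq_zero (s := r) (by fun_prop) fun x hx => by simp [hr x hx]
  refine ext_inner_left ℂ fun z => ?_
  rw [inner_zero_right]
  have h1 : functionOf A (fun x => star (f x)) z ∈ spectralSubspace A r := by
    refine mem_spectralSubspace fun g hg hgr => ?_
    have : functionOf A (fun x => g x * star (f x)) = 0 := by
      refine functionOf_eq_zero hA hl fun x _ => ?_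
      rcases le_total x r with h | h
      · simp [hgr x h]
      · simp [hr x h]
    rw [functionOf_mul hA hl hg hfs] at this
    exact congrArg (fun T => T z) this
  have h2 := (Submodule.mem_orthogonal _ _).1 hw _ h1
  rwa [functionOf_star, ContinuousLinearMap.star_eq_adjoint,
    ContinuousLinearMap.adjoint_inner_left] at h2

/-- Since `u = φ(A) u` for the cutoff `φ`, the vector `u` is in `Dom A` with `A u = (x φ)(A) u`. The
form bound holds because `(r - x) φ ≥ 0` on `(-∞, r]`. -/
theorem mem_domain_of_mem_spectralSubspace (hA : IsSelfAdjoint A) (hl : IsBoundedBelowBy A l) {u : H}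
    (hu : u ∈ spectralSubspace A r) : ∃ h : u ∈ A.domain, A ⟨u, h⟩ ∈ spectralSubspace A r ∧
      (⟪A ⟨u, h⟩, u⟫_ℂ).re ≤ r * ‖u‖ ^ 2 := by
  have hrs : r < r + 1 := by linarith
  have hφ := vanishesAtTop_cutoff hrs
  have hφ' : VanishesAtTop fun x : ℝ => (x : ℂ) * cutoff r (r + 1) x :=
    vanishesAtTop_mul_cutoff hrs (by fun_prop)
  obtain ⟨h1, h2⟩ := functionOf_mem_domain hA hl hφ hφ' u
  have h3 := functionOf_cutoff_apply hA hl hrs hu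
  have h4 : u ∈ A.domain := h3 ▸ h1
  have h5 : A ⟨u, h4⟩ = functionOf A (fun x => x * cutoff r (r + 1) x) u := by
    rw [← h2]; congr 1; exact Subtype.ext h3.symm
  refine ⟨h4, ?_, ?_⟩
  · rw [h5]; exact functionOf_mem_spectralSubspace hA hl hφ' hu
  · have h6 : VanishesAtTop fun x : ℝ => (((r - x) * cutoff r (r + 1) x : ℝ) : ℂ) := by
      simpa using vanishesAtTop_mul_cutoff hrs (g := fun x => (r : ℂ) - x) (by fun_prop)
    have h7 := re_inner_functionOf_nonneg_of_mem hA hl (r := r) h6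
      (fun x hx => by rw [cutoff_of_le hrs hx]; linarith) hu
    have h8 : functionOf A (fun x : ℝ => (((r - x) * cutoff r (r + 1) x : ℝ) : ℂ)) =
        (r : ℂ) • functionOf A (fun x => (cutoff r (r + 1) x : ℂ)) -
          functionOf A (fun x => x * cutoff r (r + 1) x) := by
      rw [← functionOf_const_mul hA hl _ hφ, ← functionOf_sub hA hl _ hφ']
      · congr 1; ext x; push_cast; ring
      · exact vanishesAtTop_mul_cutoff hrs (g := fun _ => (r : ℂ)) continuous_const
    rw [h8, sub_apply, smul_apply, h3, ← h5, inner_sub_left, inner_smul_left,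
      inner_self_eq_norm_sq_to_K] at h7
    simp [← ofReal_pow] at h7
    linarith

/-- No cutoff fixes `w`, so write `w = R v`: the form of `A - r` at `w` is that of the bounded
function `(x - r) / (x² + 1)` of `A` at `v`. -/
theorem le_re_inner_of_mem_orthogonal (hA : IsSelfAdjoint A) (hl : IsBoundedBelowBy A l)
    (w : A.domain) (hw : (w : H) ∈ (spectralSubspace A r)ᗮ) :
    r * ‖(w : H)‖ ^ 2 ≤ (⟪A w, (w : H)⟫_ℂ).re := by
  set v := A w + I • (w : H) with hv
  set R := resolventOp A (-I) with hR
  have hRv : R v = w := resolvent_map_add hA w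
  have hN : functionOf A (fun x : ℝ => ((max (r - x) 0 : ℝ) : ℂ)) (w : H) = 0 :=
    functionOf_apply_eq_zero_of_mem_orthogonal hA hl (by fun_prop)
      (fun x hx => by rw [max_eq_right (by linarith)]; simp) hw
  have hpos : ∀ x : ℝ, (0 : ℝ) < x ^ 2 + 1 := fun x => by positivity
  have hinv : ∀ x : ℝ, (((x ^ 2 + 1)⁻¹ : ℝ) : ℂ) = star ((x : ℂ) + I)⁻¹ * ((x : ℂ) + I)⁻¹ := by
    intro x
    rw [RCLike.star_def, map_inv₀, ← mul_inv, ← normSq_eq_conj_mul_self, ofReal_inv]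
    congr 2; simp [normSq_apply]; ring
  have hVs : VanishesAtTop fun x : ℝ => star ((x : ℂ) + I)⁻¹ := by
    refine ⟨vanishesAtTop_resolvent.continuous.star, ?_⟩
    simpa using vanishesAtTop_resolvent.tendsto.star
  have hV2 : VanishesAtTop fun x : ℝ => (((x ^ 2 + 1)⁻¹ : ℝ) : ℂ) := by
    simp_rw [hinv]
    exact ⟨hVs.continuous.mul vanishesAtTop_resolvent.continuous,
      by simpa using hVs.tendsto.mul vanishesAtTop_resolvent.tendsto⟩
  have hf : VanishesAtTop fun x : ℝ => (((x - r) * (x ^ 2 + 1)⁻¹ : ℝ) : ℂ) := by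
    have h1 : (fun x : ℝ => (((x - r) * (x ^ 2 + 1)⁻¹ : ℝ) : ℂ)) =
        fun x : ℝ => star ((x : ℂ) + I)⁻¹ - (r + I) * (((x ^ 2 + 1)⁻¹ : ℝ) : ℂ) := by
      ext x
      rw [ofReal_mul, hinv]
      have := add_I_ne_zero x
      field_simp
      push_cast; ring
    rw [h1]
    refine hVs.sub ⟨by have := hV2.continuous; fun_prop, by simpa using hV2.tendsto.const_mul (r + I : ℂ)⟩
  have h1 : functionOf A (fun x : ℝ => (((x - r) * (x ^ 2 + 1)⁻¹ : ℝ) : ℂ)) =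
      star R - (r + I : ℂ) • (star R * R) := by
    have h2 : VanishesAtTop fun x : ℝ => star ((x : ℂ) + I)⁻¹ * ((x : ℂ) + I)⁻¹ := by
      simp_rw [← hinv]; exact hV2
    rw [hR, ← functionOf_resolvent hA hl, ← functionOf_star,
      ← functionOf_mul hA hl hVs vanishesAtTop_resolvent, ← functionOf_const_mul hA hl _ h2,
      ← functionOf_sub hA hl hVs ⟨by have := h2.continuous; fun_prop, by simpa using h2.tendsto.const_mul (r + I : ℂ)⟩]
    congr 1
    ext x
    rw [ofReal_mul, hinv]
    have := add_I_ne_zero x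
    field_simp
    push_cast; ring
  have h2 : 0 ≤ (⟪functionOf A (fun x : ℝ => (((x - r) * (x ^ 2 + 1)⁻¹ : ℝ) : ℂ)) v, v⟫_ℂ).re := by
    rw [functionOf_eq_posPart_sub hA hl hf, sub_apply]
    have h3 : functionOf A (fun x : ℝ => ((max (-((x - r) * (x ^ 2 + 1)⁻¹)) 0 : ℝ) : ℂ)) v = 0 := by
      -- The negative part factors as `R* (r - x)₊(A) R`, and `(r - x)₊(A)` kills `R v = w`.
      have h4 : functionOf A (fun x : ℝ => ((max (-((x - r) * (x ^ 2 + 1)⁻¹)) 0 : ℝ) : ℂ)) =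
          star R * (functionOf A (fun x : ℝ => ((max (r - x) 0 : ℝ) : ℂ)) * R) := by
        have h5 : VanishesAtTop fun x : ℝ => ((max (r - x) 0 : ℝ) : ℂ) :=
          vanishesAtTop_of_eq_zero (s := r) (by fun_prop)
            (fun x hx => by rw [max_eq_right (by linarith)]; simp)
        have h6 : VanishesAtTop fun x : ℝ => ((max (r - x) 0 : ℝ) : ℂ) * ((x : ℂ) + I)⁻¹ :=
          ⟨h5.continuous.mul vanishesAtTop_resolvent.continuous,
            by simpa using h5.tendsto.mul vanishesAtTop_resolvent.tendsto⟩
        rw [hR, ← functionOf_resolvent hA hl, ← functionOf_star,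
          ← functionOf_mul hA hl h5 vanishesAtTop_resolvent, ← functionOf_mul hA hl hVs h6]
        congr 1; ext x
        have h7 : max (-((x - r) * (x ^ 2 + 1)⁻¹)) 0 = max (r - x) 0 * (x ^ 2 + 1)⁻¹ := by
          rw [max_mul_of_nonneg _ _ (inv_nonneg.2 (hpos x).le)]; congr 1 <;> ring
        rw [h7, ofReal_mul, hinv]; ring
      rw [h4, mul_apply_eq_comp, mul_apply_eq_comp, hRv, hN, _root_.map_zero]
    rw [h3, sub_zero]
    exact re_inner_functionOf_nonneg hA hl (fun x _ => le_max_right _ _) v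
  rw [h1] at h2
  have h3 : ⟪(star R - (r + I : ℂ) • (star R * R)) v, v⟫_ℂ =
      ⟪A w, (w : H)⟫_ℂ - r * ‖(w : H)‖ ^ 2 := by
    simp only [sub_apply, smul_apply, mul_apply_eq_comp, inner_sub_left, inner_smul_left,
      ContinuousLinearMap.star_eq_adjoint, ContinuousLinearMap.adjoint_inner_left]
    rw [hRv, hv, inner_add_left, inner_smul_left, inner_self_eq_norm_sq_to_K]
    simp
    ring
  rw [h3] at h2
  simp only [sub_re, ← ofReal_pow, ← ofReal_mul, ofReal_re] at h2
  linarith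

theorem spectralProjection_mem (A : H →ₗ.[ℂ] H) (r : ℝ) (u : H) :
    spectralProjection A r u ∈ spectralSubspace A r :=
  Submodule.starProjection_apply_mem _ _

theorem sub_spectralProjection_mem (A : H →ₗ.[ℂ] H) (r : ℝ) (u : H) :
    u - spectralProjection A r u ∈ (spectralSubspace A r)ᗮ :=
  Submodule.sub_starProjection_mem_orthogonal _

/-- The cross terms of the form vanish, since `A` keeps the spectral component in the spectral
subspace. Hence a vector whose form lies below `r ‖u‖²` must have a sizeable component in that
subspace. -/
theorem spectralProjection_lower_bound (hA : IsSelfAdjoint A) (hl : IsBoundedBelowBy A l)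
    (u : A.domain) :
    l * ‖spectralProjection A r u‖ ^ 2 + r * (‖(u : H)‖ ^ 2 - ‖spectralProjection A r u‖ ^ 2) ≤
      (⟪A u, (u : H)⟫_ℂ).re := by
  set p := spectralProjection A r (u : H) with hp
  obtain ⟨h1, h2, -⟩ := mem_domain_of_mem_spectralSubspace hA hl (spectralProjection_mem A r (u : H))
  have hq := sub_spectralProjection_mem A r (u : H)
  set P : A.domain := ⟨p, h1⟩ with hP
  set Q : A.domain := u - P with hQ
  have hQm : (Q : H) ∈ (spectralSubspace A r)ᗮ := hq
  have h3 := le_re_inner_of_mem_orthogonal hA hl Q hQm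
  have h4 := hl P
  have h5 : u = P + Q := by rw [hQ]; abel
  have h6 : ⟪A P, (Q : H)⟫_ℂ = 0 := (Submodule.mem_orthogonal _ _).1 hQm _ h2
  have h7 : ⟪A Q, (P : H)⟫_ℂ = 0 := by
    rw [inner_map_eq hA, ← inner_conj_symm, h6, _root_.map_zero]
  have h8 : ⟪(P : H), (Q : H)⟫_ℂ = 0 :=
    (Submodule.mem_orthogonal _ _).1 hQm _ (spectralProjection_mem A r (u : H))
  have h9 : ‖(u : H)‖ ^ 2 = ‖(P : H)‖ ^ 2 + ‖(Q : H)‖ ^ 2 := by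
    have := norm_add_sq_eq_norm_sq_add_norm_sq_of_inner_eq_zero (𝕜 := ℂ) (P : H) Q h8
    rw [h5, sq, sq, sq]; exact this
  have h10 : ⟪A u, (u : H)⟫_ℂ = ⟪A P, (P : H)⟫_ℂ + ⟪A Q, (Q : H)⟫_ℂ := by
    have h11 : A u = A P + A Q := by rw [← LinearPMap.map_add, ← h5]
    have h12 : (u : H) = (P : H) + Q := congrArg Subtype.val h5
    rw [h11, h12, inner_add_left, inner_add_right, inner_add_right, h6, h7]; ring
  rw [h10, add_re, h9]
  change l * ‖(P : H)‖ ^ 2 + r * (‖(P : H)‖ ^ 2 + ‖(Q : H)‖ ^ 2 - ‖(P : H)‖ ^ 2) ≤ _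
  linarith

/-- With no spectrum in `(r, s)` the continuous cutoff agrees on the spectrum with the indicator of
`(-∞, r]`. -/
theorem spectralProjection_eq_functionOf_cutoff (hA : IsSelfAdjoint A) (hl : IsBoundedBelowBy A l)
    (h : r < s) (hgap : ∀ x ∈ Set.Ioo r s, ¬ InSpectrum A x) :
    spectralProjection A r = functionOf A (fun x => (cutoff r s x : ℂ)) := by
  ext w
  rw [spectralProjection]
  refine Submodule.eq_starProjection_of_mem_orthogonal ?_ ?_
  · refine mem_spectralSubspace fun f hf hfr => ?_
    have : functionOf A (fun x => f x * cutoff r s x) = 0 := by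
      rw [← functionOf_zero A]
      refine functionOf_congr hA hl fun x _ hx => ?_
      rcases le_or_gt x r with h1 | h1
      · simp [hfr x h1]
      · rcases le_or_gt s x with h2 | h2
        · simp [cutoff_of_ge h h2]
        · exact absurd hx (hgap x ⟨h1, h2⟩)
    rw [functionOf_mul hA hl hf (vanishesAtTop_cutoff h)] at this
    exact congrArg (fun T => T w) this
  · refine (Submodule.mem_orthogonal _ _).2 fun u hu => ?_
    have h1 := isSelfAdjoint_functionOf A (cutoff r s)
    have h2 : ⟪u, functionOf A (fun x => (cutoff r s x : ℂ)) w⟫_ℂ = ⟪u, w⟫_ℂ := by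
      rw [← ContinuousLinearMap.adjoint_inner_left, ← ContinuousLinearMap.star_eq_adjoint,
        h1.star_eq, functionOf_cutoff_apply hA hl h hu]
    rw [inner_sub_right, h2, sub_self]

theorem spectralProjection_eq_of_gap (hA : IsSelfAdjoint A) (hl : IsBoundedBelowBy A l)
    {a b : ℝ} (hgap : ∀ x ∈ Set.Ioo a b, ¬ InSpectrum A x) (hr : r ∈ Set.Ioo a b)
    (hs : s ∈ Set.Ioo a b) : spectralProjection A r = spectralProjection A s := by
  have key : ∀ {r s : ℝ}, r ∈ Set.Ioo a b → s ∈ Set.Ioo a b → r < s →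
      spectralProjection A r = spectralProjection A s := by
    intro r s hr hs h
    have hrb : r < b := hr.2
    have hsb : s < b := hs.2
    rw [spectralProjection_eq_functionOf_cutoff hA hl hrb
        (fun x hx => hgap x ⟨hr.1.trans hx.1, hx.2⟩),
      spectralProjection_eq_functionOf_cutoff hA hl hsb
        (fun x hx => hgap x ⟨hs.1.trans hx.1, hx.2⟩)]
    refine functionOf_congr hA hl fun x _ hx => ?_
    rcases le_or_gt x r with h1 | h1
    · rw [cutoff_of_le hrb h1, cutoff_of_le hsb (h1.trans h.le)]
    · rcases le_or_gt b x with h2 | h2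
      · rw [cutoff_of_ge hrb h2, cutoff_of_ge hsb h2]
      · exact absurd hx (hgap x ⟨hr.1.trans h1, h2⟩)
  rcases lt_trichotomy r s with h | rfl | h
  · exact key hr hs h
  · rfl
  · exact (key hs hr h).symm

/-- A bump positive exactly on `(r, s)` kills the range of `E(r)` and the complement of that of
`E(s)`. If these projections agree, the bump of `A` is zero, so the bump vanishes on the spectrum.
-/
theorem not_inSpectrum_of_spectralProjection_eq (hA : IsSelfAdjoint A) (hl : IsBoundedBelowBy A l)
    (heq : spectralProjection A r = spectralProjection A s) :
    ∀ x ∈ Set.Ioo r s, ¬ InSpectrum A x := by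
  intro x hx hsp
  set f : ℝ → ℂ := fun x => ((max 0 ((x - r) * (s - x)) : ℝ) : ℂ) with hf
  have hfs : ∀ x, s ≤ x → f x = 0 := fun x hx' => by
    rw [hf]; dsimp only
    rw [max_eq_left]; · simp
    exact mul_nonpos_of_nonneg_of_nonpos (by linarith [hx.1, hx.2]) (by linarith)
  have hfr : ∀ x ≤ r, f x = 0 := fun x hx' => by
    rw [hf]; dsimp only
    rw [max_eq_left]; · simp
    exact mul_nonpos_of_nonpos_of_nonneg (by linarith) (by linarith [hx.1, hx.2])
  have hfc : Continuous f := by fun_prop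
  have hfv := vanishesAtTop_of_eq_zero hfc hfs
  have h0 : functionOf A f = 0 := by
    ext w
    have h1 : functionOf A f (spectralProjection A r w) = 0 :=
      functionOf_apply_eq_zero hfv hfr (spectralProjection_mem A r w)
    have h2 : functionOf A f (w - spectralProjection A s w) = 0 :=
      functionOf_apply_eq_zero_of_mem_orthogonal hA hl hfc hfs (sub_spectralProjection_mem A s w)
    rw [_root_.map_sub, ← heq, h1, sub_zero] at h2
    simpa using h2
  have hn := isStarNormal_resolvent hA
  rw [functionOf_def, ← cfc_const_zero ℂ (resolventOp A (-I))] at h0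
  have h1 := (cfc_eq_cfc_iff_eqOn (R := ℂ) hn (continuousOn_transferred hA hl hfv)
    continuousOn_const).1 h0 hsp
  simp only at h1
  rw [transferred_of_ne (inv_ne_zero (add_I_ne_zero x)), inv_inv] at h1
  simp only [add_re, ofReal_re, I_re, add_zero, hf, ofReal_eq_zero] at h1
  have : 0 < (x - r) * (s - x) := mul_pos (by linarith [hx.1]) (by linarith [hx.2])
  rw [max_eq_right this.le] at h1
  exact this.ne' h1

/-- If `S = (A - x)⁻¹` and `c = x + i`, then `1 + c S` inverts `1 - c R`, so `c⁻¹ - R` is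
invertible. -/
theorem not_inSpectrum_of_notMem_opSpectrum (hA : IsSelfAdjoint A) {x : ℝ}
    (hx : (x : ℂ) ∉ opSpectrum A) : ¬ InSpectrum A x := by
  obtain ⟨S, hS⟩ : ∃ S : H →L[ℂ] H, IsResolventAt A x S := by
    by_contra h; exact hx h
  set R := resolventOp A (-I) with hR
  set c : ℂ := x + I with hc
  have hc0 : c ≠ 0 := add_I_ne_zero x
  have h1 : ∀ v, R v + c • R (S v) = S v := by
    intro v
    obtain ⟨h, hv⟩ := hS.1 v
    have h2 := resolvent_map_add hA ⟨S v, h⟩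
    rw [eq_add_of_sub_eq hv] at h2
    rw [← hR] at h2
    simp only [_root_.map_add, _root_.map_smul] at h2
    rw [hc, add_smul, ← add_assoc]
    exact h2
  have h2 : ∀ v, S v - c • S (R v) = R v := by
    intro v
    have h2 := hS.2 ⟨R v, resolvent_mem_domain hA v⟩
    rw [map_resolvent hA, ← hR] at h2
    simp only [_root_.map_sub, _root_.map_smul] at h2
    rw [hc, add_smul, ← sub_sub, sub_right_comm]
    exact h2
  have h3 : (1 - c • R) * (1 + c • S) = 1 := by
    ext v
    simp only [mul_apply_eq_comp, sub_apply, add_apply, one_apply_eq_self, smul_apply, _root_.map_add, _root_.map_smul]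
    have := h1 v
    linear_combination (norm := module) (-c) • this
  have h4 : (1 + c • S) * (1 - c • R) = 1 := by
    ext v
    simp only [mul_apply_eq_comp, sub_apply, add_apply, one_apply_eq_self, smul_apply, _root_.map_sub, _root_.map_smul]
    have := h2 v
    linear_combination (norm := module) c • this
  rw [InSpectrum, ← hc, spectrum.notMem_iff]
  have h5 : algebraMap ℂ (H →L[ℂ] H) c⁻¹ - R = c⁻¹ • (1 - c • R) := by
    rw [smul_sub, smul_smul, inv_mul_cancel₀ hc0, one_smul, Algebra.algebraMap_eq_smul_one]
  rw [h5]
  have h6 : IsUnit (1 - c • R) := ⟨⟨_, _, h3, h4⟩, rfl⟩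
  exact h6.smul (Units.mk0 c⁻¹ (inv_ne_zero hc0))

end SpectralSubspaces

/-! ### Holomorphic functions truncated to a half-plane -/

section HalfPlane

/-- The function that is `g` on the half-plane `Re z > m` and `0` elsewhere. -/
noncomputable def onHalfPlane (m : ℝ) (g : ℂ → ℂ) (z : ℂ) : ℂ := if m < z.re then g z else 0

theorem onHalfPlane_of_lt {m : ℝ} (g : ℂ → ℂ) {z : ℂ} (h : m < z.re) : onHalfPlane m g z = g z :=
  if_pos h

theorem onHalfPlane_of_le {m : ℝ} (g : ℂ → ℂ) {z : ℂ} (h : z.re ≤ m) : onHalfPlane m g z = 0 :=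
  if_neg h.not_gt

theorem isOpen_re_ne (m : ℝ) : IsOpen {z : ℂ | z.re ≠ m} :=
  isOpen_ne_fun Complex.continuous_re continuous_const

theorem differentiableOn_onHalfPlane {m : ℝ} {g : ℂ → ℂ} (hg : DifferentiableOn ℂ g {z | m < z.re}) :
    DifferentiableOn ℂ (onHalfPlane m g) {z | z.re ≠ m} := by
  intro z hz
  refine DifferentiableAt.differentiableWithinAt ?_
  rcases lt_or_gt_of_ne hz with h | h
  · have ho : IsOpen {z : ℂ | z.re < m} := isOpen_lt Complex.continuous_re continuous_const
    refine (differentiableAt_const (0 : ℂ)).congr_of_eventuallyEq ?_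
    filter_upwards [ho.mem_nhds h] with w hw using onHalfPlane_of_le g (le_of_lt hw)
  · have ho : IsOpen {z : ℂ | m < z.re} := isOpen_lt continuous_const Complex.continuous_re
    refine (hg.differentiableAt (ho.mem_nhds h)).congr_of_eventuallyEq ?_
    filter_upwards [ho.mem_nhds h] with w hw using onHalfPlane_of_lt g hw

end HalfPlane

/-! ### Spectral projections as functions of the heat operator -/

section Heat

open Complex Filter Topology

variable {H : Type*} [NormedAddCommGroup H] [InnerProductSpace ℂ H] [CompleteSpace H]
  {A : H →ₗ.[ℂ] H} {l r s t : ℝ}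

theorem vanishesAtTop_exp (ht : 0 < t) : VanishesAtTop fun x => (Real.exp (-t * x) : ℂ) := by
  refine ⟨by fun_prop, ?_⟩
  have h1 : Tendsto (fun x : ℝ => -t * x) atTop atBot :=
    tendsto_id.const_mul_atTop_of_neg (by linarith)
  have h2 := (continuous_ofReal.tendsto _).comp (Real.tendsto_exp_atBot.comp h1)
  simpa [Function.comp_def] using h2

theorem isSelfAdjoint_heatOperator (A : H →ₗ.[ℂ] H) (t : ℝ) : IsSelfAdjoint (heatOperator A t) :=
  isSelfAdjoint_functionOf A fun x => Real.exp (-t * x)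

theorem heatOperator_eq_cfc (A : H →ₗ.[ℂ] H) (t : ℝ) : heatOperator A t =
    cfc (transferred fun x => (Real.exp (-t * x) : ℂ)) (resolventOp A (-I)) :=
  functionOf_def A _

theorem mem_spectrum_heatOperator (hA : IsSelfAdjoint A) (hl : IsBoundedBelowBy A l) (ht : 0 < t)
    {z : ℂ} (hz : z ∈ spectrum ℂ (heatOperator A t)) :
    z = 0 ∨ ∃ x, l ≤ x ∧ InSpectrum A x ∧ z = (Real.exp (-t * x) : ℝ) := by
  have hn := isStarNormal_resolvent hA
  rw [heatOperator_eq_cfc, cfc_map_spectrum _ _ hn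
    (continuousOn_transferred hA hl (vanishesAtTop_exp ht))] at hz
  obtain ⟨w, hw, rfl⟩ := hz
  rcases mem_spectrum_cases hA hl hw with rfl | ⟨h0, -, h2, h3⟩
  · exact Or.inl (transferred_zero _)
  · exact Or.inr ⟨_, h2, h3, transferred_of_ne h0⟩

/-- A spectral gap of `A` yields a gap of the heat operator. -/
theorem mem_spectrum_heatOperator_of_gap (hA : IsSelfAdjoint A) (hl : IsBoundedBelowBy A l)
    (hgap : ∀ x ∈ Set.Ioo r s, ¬ InSpectrum A x)
    {z : ℂ} (hz : z ∈ spectrum ℂ (heatOperator A 1)) :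
    z.im = 0 ∧ (z.re ∈ Set.Icc 0 (Real.exp (-s)) ∨ z.re ∈ Set.Icc (Real.exp (-r)) (Real.exp (-l))) := by
  rcases mem_spectrum_heatOperator hA hl one_pos hz with rfl | ⟨x, hx, hsp, rfl⟩
  · exact ⟨rfl, Or.inl ⟨le_rfl, (Real.exp_pos _).le⟩⟩
  · refine ⟨ofReal_im _, ?_⟩
    rw [ofReal_re, neg_one_mul]
    rcases le_or_gt x r with h1 | h1
    · exact Or.inr ⟨Real.exp_le_exp.2 (by linarith), Real.exp_le_exp.2 (by linarith)⟩
    · rcases le_or_gt s x with h2 | h2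
      · exact Or.inl ⟨(Real.exp_pos _).le, Real.exp_le_exp.2 (by linarith)⟩
      · exact absurd hsp (hgap x ⟨h1, h2⟩)

/-- The map `x ↦ e^{-x}` reverses order and turns the gap `(r, s)` into a gap around `m`. So `E(r)`
is the indicator of `Re z > m` applied to `e^{-A}`, a function holomorphic near the spectrum. -/
theorem spectralProjection_eq_cfc_heatOperator (hA : IsSelfAdjoint A) (hl : IsBoundedBelowBy A l)
    (h : r < s) (hgap : ∀ x ∈ Set.Ioo r s, ¬ InSpectrum A x) {m : ℝ}
    (hm : m ∈ Set.Ioo (Real.exp (-s)) (Real.exp (-r))) :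
    spectralProjection A r = cfc (onHalfPlane m fun _ => 1) (heatOperator A 1) := by
  have hn := isStarNormal_resolvent hA
  have hv := vanishesAtTop_exp one_pos
  have hm0 : 0 < m := (Real.exp_pos _).trans hm.1
  have hc : ContinuousOn (onHalfPlane m fun _ => 1)
      (transferred (fun x => (Real.exp (-1 * x) : ℂ)) '' spectrum ℂ (resolventOp A (-I))) := by
    rw [← cfc_map_spectrum _ _ hn (continuousOn_transferred hA hl hv), ← heatOperator_eq_cfc]
    refine (differentiableOn_onHalfPlane (differentiableOn_const _)).continuousOn.mono fun z hz => ?_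
    rcases (mem_spectrum_heatOperator_of_gap hA hl hgap hz).2 with h1 | h1
    · exact (h1.2.trans_lt hm.1).ne
    · exact (hm.2.trans_le h1.1).ne'
  rw [heatOperator_eq_cfc, ← cfc_comp _ _ _ hn hc (continuousOn_transferred hA hl hv),
    spectralProjection_eq_functionOf_cutoff hA hl h hgap, functionOf_def]
  refine cfc_congr fun w hw => ?_
  rcases mem_spectrum_cases hA hl hw with rfl | ⟨h0, -, h2, h3⟩
  · rw [Function.comp_apply, transferred_zero, transferred_zero, onHalfPlane_of_le]
    simpa using hm0.le
  · rw [Function.comp_apply, transferred_of_ne h0, transferred_of_ne h0]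
    generalize (w⁻¹).re = x at h2 h3
    rcases le_or_gt x r with h4 | h4
    · rw [cutoff_of_le h h4, onHalfPlane_of_lt]
      · simp
      · rw [ofReal_re, neg_one_mul]
        exact hm.2.trans_le (Real.exp_le_exp.2 (by linarith))
    · rcases le_or_gt s x with h5 | h5
      · rw [cutoff_of_ge h h5, onHalfPlane_of_le]
        · simp
        · rw [ofReal_re, neg_one_mul]
          exact (Real.exp_le_exp.2 (by linarith)).trans hm.1.le
      · exact absurd h3 (hgap x ⟨h4, h5⟩)

/-- The operator `f(A)` is `k(e^{-A})` with `k(y) = f(-log y)` extended by `0`; `k` is continuous at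
`0` because `f` vanishes at `+∞`. -/
theorem commute_functionOf (hA : IsSelfAdjoint A) (hl : IsBoundedBelowBy A l) {f : ℝ → ℂ}
    (hf : VanishesAtTop f) {Y : H →L[ℂ] H} (hY : Commute (heatOperator A 1) Y) :
    Commute (functionOf A f) Y := by
  have hn := isStarNormal_resolvent hA
  have hv := vanishesAtTop_exp one_pos
  set k : ℂ → ℂ := fun z => if 0 < z.re then f (-Real.log z.re) else 0 with hk
  have hkc : ContinuousOn k
      (transferred (fun x => (Real.exp (-1 * x) : ℂ)) '' spectrum ℂ (resolventOp A (-I))) := by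
    intro z hz
    rw [← cfc_map_spectrum _ _ hn (continuousOn_transferred hA hl hv), ← heatOperator_eq_cfc] at hz
    refine ContinuousAt.continuousWithinAt ?_
    have hreal : ContinuousAt (fun y : ℝ => if 0 < y then f (-Real.log y) else 0) z.re := by
      rcases mem_spectrum_heatOperator hA hl one_pos hz with rfl | ⟨x, hx, hsp, rfl⟩
      · rw [zero_re, ContinuousAt, if_neg (lt_irrefl _), ← nhdsLE_sup_nhdsGT]
        refine Tendsto.sup ?_ ?_
        · refine tendsto_const_nhds.congr' ?_
          filter_upwards [self_mem_nhdsWithin] with y hy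
          rw [if_neg (not_lt.2 hy)]
        · have h1 : Tendsto (fun y : ℝ => f (-Real.log y)) (𝓝[>] 0) (𝓝 0) :=
            hf.tendsto.comp (tendsto_neg_atBot_atTop.comp Real.tendsto_log_nhdsGT_zero)
          refine h1.congr' ?_
          filter_upwards [self_mem_nhdsWithin] with y hy
          rw [if_pos (Set.mem_Ioi.1 hy)]
      · rw [ofReal_re]
        have hpos : 0 < Real.exp (-1 * x) := Real.exp_pos _
        have h1 : (fun y : ℝ => if 0 < y then f (-Real.log y) else 0) =ᶠ[𝓝 (Real.exp (-1 * x))]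
            fun y => f (-Real.log y) := by
          filter_upwards [lt_mem_nhds hpos] with y hy using if_pos hy
        refine ContinuousAt.congr ?_ h1.symm
        exact hf.continuous.continuousAt.comp (Real.continuousAt_log hpos.ne').neg
    exact ContinuousAt.comp (f := Complex.re) hreal continuous_re.continuousAt
  have h1 : functionOf A f = cfc k (heatOperator A 1) := by
    rw [heatOperator_eq_cfc, ← cfc_comp _ _ _ hn hkc (continuousOn_transferred hA hl hv),
      functionOf_def]
    refine cfc_congr fun w hw => ?_
    rcases mem_spectrum_cases hA hl hw with rfl | ⟨h0, -, h2, h3⟩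
    · rw [Function.comp_apply, transferred_zero, transferred_zero, hk]
      simp
    · rw [Function.comp_apply, transferred_of_ne h0, transferred_of_ne h0, hk]
      generalize (w⁻¹).re = x
      simp only [ofReal_re, Real.exp_pos, if_true, Real.log_exp, neg_one_mul, neg_neg]
  rw [h1]
  refine (Commute.cfc hY ?_ k)
  rw [(isSelfAdjoint_heatOperator A 1).star_eq]; exact hY

/-- Both `Y` and `Y*` preserve the spectral subspace. No gap is required, so this applies to `E(r)`
before anything is known about the spectrum near `r`. -/
theorem commute_spectralProjection (hA : IsSelfAdjoint A) (hl : IsBoundedBelowBy A l)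
    {Y : H →L[ℂ] H} (hY : Commute (heatOperator A 1) Y) :
    Commute (spectralProjection A r) Y := by
  have key : ∀ {Y : H →L[ℂ] H}, Commute (heatOperator A 1) Y → ∀ u ∈ spectralSubspace A r,
      Y u ∈ spectralSubspace A r := by
    intro Y hY u hu
    refine mem_spectralSubspace fun f hf hr => ?_
    have h := commute_functionOf hA hl hf hY
    have h1 : functionOf A f (Y u) = Y (functionOf A f u) := congrArg (fun T => T u) h.eq
    rw [h1, functionOf_apply_eq_zero hf hr hu, _root_.map_zero]
  have hYs : Commute (heatOperator A 1) (star Y) := by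
    have := hY.star_star
    rwa [(isSelfAdjoint_heatOperator A 1).star_eq] at this
  ext w
  refine Submodule.eq_starProjection_of_mem_orthogonal (key hY _ (spectralProjection_mem A r w)) ?_
  rw [mul_apply_eq_comp, ContinuousLinearMap.coe_coe, ← _root_.map_sub]
  refine (Submodule.mem_orthogonal _ _).2 fun u hu => ?_
  rw [← ContinuousLinearMap.adjoint_inner_left, ← ContinuousLinearMap.star_eq_adjoint]
  exact (Submodule.mem_orthogonal _ _).1 (sub_spectralProjection_mem A r w) _ (key hYs u hu)

theorem isStarProjection_spectralProjection (A : H →ₗ.[ℂ] H) (r : ℝ) :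
    IsStarProjection (spectralProjection A r) := isStarProjection_starProjection

theorem spectralProjection_apply_of_mem {u : H} (hu : u ∈ spectralSubspace A r) :
    spectralProjection A r u = u := Submodule.starProjection_eq_self_iff.2 hu

/-- On the spectral subspace `e^{-x} ≥ e^{-r}`, on its complement the heat operator is nonnegative,
and the cross terms vanish. This makes the trace of `E(r)` finite. -/
theorem smul_spectralProjection_le_heatOperator (hA : IsSelfAdjoint A) (hl : IsBoundedBelowBy A l) :
    ((Real.exp (-r) : ℝ) : ℂ) • spectralProjection A r ≤ heatOperator A 1 := by
  set E := spectralProjection A r with hE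
  set K := heatOperator A 1 with hK
  have hv := vanishesAtTop_exp one_pos
  have hEsa : IsSelfAdjoint E := (isStarProjection_spectralProjection A r).isSelfAdjoint
  rw [ContinuousLinearMap.le_def, ContinuousLinearMap.isPositive_def']
  refine ⟨(isSelfAdjoint_heatOperator A 1).sub ?_, fun u => ?_⟩
  · rw [IsSelfAdjoint, star_smul, hEsa.star_eq, RCLike.star_def, conj_ofReal]
  · rw [ContinuousLinearMap.reApplyInnerSelf_apply]
    set p := E u with hp
    set q := u - p with hq
    have hpm : p ∈ spectralSubspace A r := spectralProjection_mem A r u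
    have hqm : q ∈ (spectralSubspace A r)ᗮ := sub_spectralProjection_mem A r u
    have hu : u = p + q := by rw [hq]; abel
    have hKp : K p ∈ spectralSubspace A r := functionOf_mem_spectralSubspace hA hl hv hpm
    have h1 : ⟪K p, q⟫_ℂ = 0 := (Submodule.mem_orthogonal _ _).1 hqm _ hKp
    have h2 : ⟪K q, p⟫_ℂ = 0 := by
      have hKs : IsSelfAdjoint K := isSelfAdjoint_heatOperator A 1
      rw [← hKs.star_eq, ContinuousLinearMap.star_eq_adjoint,
        ContinuousLinearMap.adjoint_inner_left, ← inner_conj_symm, h1, _root_.map_zero]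
    have h3 : ⟪p, q⟫_ℂ = 0 := (Submodule.mem_orthogonal _ _).1 hqm _ hpm
    have h4 : 0 ≤ (⟪K q, q⟫_ℂ).re :=
      re_inner_functionOf_nonneg hA hl (f := fun x => Real.exp (-1 * x))
        (fun x _ => (Real.exp_pos _).le) q
    have hrs : r < r + 1 := by linarith
    have hφ := vanishesAtTop_cutoff hrs
    have hcφ : VanishesAtTop fun x => ((Real.exp (-r) : ℝ) : ℂ) * (cutoff r (r + 1) x : ℂ) :=
      vanishesAtTop_mul_cutoff hrs continuous_const
    have h5 : VanishesAtTop fun x : ℝ =>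
        ((Real.exp (-1 * x) - Real.exp (-r) * cutoff r (r + 1) x : ℝ) : ℂ) := by
      simpa only [ofReal_sub, ofReal_mul] using hv.sub hcφ
    have h6 := re_inner_functionOf_nonneg_of_mem hA hl (r := r) h5 (fun x hx => by
      rw [cutoff_of_le hrs hx, mul_one, neg_one_mul, sub_nonneg]
      exact Real.exp_le_exp.2 (by linarith)) hpm
    have h7 : functionOf A (fun x : ℝ =>
        ((Real.exp (-1 * x) - Real.exp (-r) * cutoff r (r + 1) x : ℝ) : ℂ)) p =
        K p - ((Real.exp (-r) : ℝ) : ℂ) • p := by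
      simp only [ofReal_sub, ofReal_mul]
      rw [functionOf_sub hA hl hv hcφ, functionOf_const_mul hA hl _ hφ, sub_apply, smul_apply,
        functionOf_cutoff_apply hA hl hrs hpm]
      rfl
    rw [h7, inner_sub_left, inner_smul_left] at h6
    have h8 : ⟪(K - ((Real.exp (-r) : ℝ) : ℂ) • E) u, u⟫_ℂ =
        ⟪K p, p⟫_ℂ - (starRingEnd ℂ) ((Real.exp (-r) : ℝ) : ℂ) * ⟪p, p⟫_ℂ + ⟪K q, q⟫_ℂ := by
      rw [sub_apply, smul_apply, ← hp, inner_sub_left, inner_smul_left]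
      nth_rw 1 2 3 [hu]
      rw [_root_.map_add, inner_add_left, inner_add_right, inner_add_right, inner_add_right, h1, h2, h3]
      ring
    rw [h8, RCLike.re_eq_complex_re, add_re]
    exact add_nonneg h6 h4

end Heat

/-! ### Circles parametrized by `[0, 1]` and Cauchy's formula -/

section Contours

open Complex Metric

/-- The circle of centre `c` and radius `R`, parametrized by `[0, 1]`. -/
noncomputable def unitCircleMap (c : ℂ) (R : ℝ) (t : ℝ) : ℂ := circleMap c R (2 * Real.pi * t)

theorem contDiff_unitCircleMap (c : ℂ) (R : ℝ) : ContDiff ℝ 1 (unitCircleMap c R) :=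
  (contDiff_circleMap c R).comp (by fun_prop)

theorem deriv_unitCircleMap (c : ℂ) (R t : ℝ) : deriv (unitCircleMap c R) t =
    (2 * Real.pi : ℝ) • deriv (circleMap c R) (2 * Real.pi * t) := by
  have h1 : HasDerivAt (fun t : ℝ => 2 * Real.pi * t) (2 * Real.pi) t := by
    simpa using (hasDerivAt_id t).const_mul (2 * Real.pi)
  have h2 := (hasDerivAt_circleMap c R (2 * Real.pi * t)).scomp t h1
  rw [(hasDerivAt_circleMap c R _).deriv]
  exact h2.deriv

theorem integral_unitCircleMap {E : Type*} [NormedAddCommGroup E] [NormedSpace ℂ E] (c : ℂ) (R : ℝ)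
    (F : ℂ → E) : ∫ t in (0 : ℝ)..1, deriv (unitCircleMap c R) t • F (unitCircleMap c R t) =
      ∮ z in C(c, R), F z := by
  have h := intervalIntegral.smul_integral_comp_mul_left (a := 0) (b := 1)
    (fun θ => deriv (circleMap c R) θ • F (circleMap c R θ)) (2 * Real.pi)
  rw [mul_zero, mul_one, ← intervalIntegral.integral_smul] at h
  rw [circleIntegral, ← h]
  refine intervalIntegral.integral_congr fun t _ => ?_
  rw [deriv_unitCircleMap, smul_assoc]; rfl

theorem unitCircleMap_mem_sphere (c : ℂ) {R : ℝ} (hR : 0 ≤ R) (t : ℝ) :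
    unitCircleMap c R t ∈ sphere c R := circleMap_mem_sphere c hR _

theorem circleIntegral_inv_sub_mul_of_mem {c w : ℂ} {R : ℝ} {F : ℂ → ℂ} {U : Set ℂ}
    (hF : DifferentiableOn ℂ F U) (hU : closedBall c R ⊆ U) (hw : w ∈ ball c R) :
    ∮ z in C(c, R), F z * (z - w)⁻¹ = 2 * Real.pi * I * F w := by
  have := (hF.mono hU).diffContOnCl_ball (c := c) (R := R) subset_rfl |>.circleIntegral_sub_inv_smul hw
  simpa [mul_comm] using this

theorem circleIntegral_inv_sub_mul_of_notMem {c w : ℂ} {R : ℝ} (hR : 0 ≤ R) {F : ℂ → ℂ} {U : Set ℂ}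
    (hF : DifferentiableOn ℂ F U) (hU : closedBall c R ⊆ U) (hw : w ∉ closedBall c R) :
    ∮ z in C(c, R), F z * (z - w)⁻¹ = 0 := by
  refine DiffContOnCl.circleIntegral_eq_zero hR
    (DifferentiableOn.diffContOnCl_ball (U := closedBall c R) ?_ subset_rfl)
  refine (hF.mono hU).mul (DifferentiableOn.inv (by fun_prop) fun z hz h => hw ?_)
  rwa [← sub_eq_zero.1 h]

end Contours

/-! ### Contour integrals inside the continuous functional calculus -/

section CfcIntegral

open MeasureTheory Set Function

theorem cfc_intervalIntegral {B : Type*} [CStarAlgebra B] (x : B) [IsStarNormal x]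
    (F : ℝ → ℂ → ℂ) (hF : ContinuousOn (uncurry F) (univ ×ˢ spectrum ℂ x)) {a b : ℝ} (hab : a ≤ b) :
    cfc (fun w => ∫ t in a..b, F t w) x = ∫ t in a..b, cfc (F t) x := by
  have hK : IsCompact (Icc a b ×ˢ spectrum ℂ x) := isCompact_Icc.prod (spectrum.isCompact x)
  obtain ⟨C, hC⟩ := hK.exists_bound_of_continuousOn
    (hF.mono (prod_mono (subset_univ _) subset_rfl))
  simp_rw [intervalIntegral.integral_of_le hab]
  refine cfc_setIntegral measurableSet_Ioc F (fun _ => C) x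
    (hF.mono (prod_mono (subset_univ _) subset_rfl)) ?_ ?_
  · refine ae_restrict_of_forall_mem measurableSet_Ioc fun t ht z hz => ?_
    exact hC (t, z) ⟨Ioc_subset_Icc_self ht, hz⟩
  · exact (integrable_const C).hasFiniteIntegral

theorem cfc_sub_inv_eq_resolvent {B : Type*} [CStarAlgebra B] (x : B) [IsStarNormal x] {z : ℂ}
    (hz : z ∉ spectrum ℂ x) : cfc (fun w => (z - w)⁻¹) x = resolvent x z := by
  rw [cfc_inv (fun w => z - w) x fun w hw h => hz (by rwa [sub_eq_zero.1 h]),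
    cfc_sub (fun _ => z) (fun w => w) x, cfc_const z x, cfc_id' ℂ x, resolvent]

/-- Cauchy's formula for the continuous functional calculus: the integral of `f(z) (z - x)⁻¹` along
a circle is the function of `x` given by the integrals of `f(z) (z - w)⁻¹`. -/
theorem integral_smul_resolvent {B : Type*} [CStarAlgebra B] (x : B) [IsStarNormal x] {f h : ℂ → ℂ}
    {U : Set ℂ} (hf : ContinuousOn f U) {c : ℂ} {R : ℝ}
    (hmem : ∀ t, unitCircleMap c R t ∈ U \ spectrum ℂ x)
    (hh : ∀ w ∈ spectrum ℂ x, ∮ z in C(c, R), f z * (z - w)⁻¹ = h w) :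
    ∫ t in (0 : ℝ)..1, deriv (unitCircleMap c R) t •
      (f (unitCircleMap c R t) • resolvent x (unitCircleMap c R t)) = cfc h x := by
  have hc : Continuous (unitCircleMap c R) := (contDiff_unitCircleMap c R).continuous
  have hd : Continuous (deriv (unitCircleMap c R)) :=
    (contDiff_unitCircleMap c R).continuous_deriv le_rfl
  have hfc : Continuous fun t => f (unitCircleMap c R t) :=
    hf.comp_continuous hc fun t => (hmem t).1
  have hne : ∀ t, ∀ w ∈ spectrum ℂ x, unitCircleMap c R t - w ≠ 0 := fun t w hw h =>
    (hmem t).2 (by rwa [sub_eq_zero.1 h])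
  have h1 := cfc_intervalIntegral x (fun t w => deriv (unitCircleMap c R) t *
    (f (unitCircleMap c R t) * (unitCircleMap c R t - w)⁻¹)) (by
      simp only [uncurry_def]
      refine (hd.comp continuous_fst).continuousOn.mul
        ((hfc.comp continuous_fst).continuousOn.mul (ContinuousOn.inv₀
          ((hc.comp continuous_fst).sub continuous_snd).continuousOn ?_))
      rintro ⟨t, w⟩ ⟨-, hw⟩
      exact hne t w hw) zero_le_one
  have h2 : ∀ t, cfc (fun w => deriv (unitCircleMap c R) t *
      (f (unitCircleMap c R t) * (unitCircleMap c R t - w)⁻¹)) x = deriv (unitCircleMap c R) t •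
      (f (unitCircleMap c R t) • resolvent x (unitCircleMap c R t)) := by
    intro t
    have h3 : ContinuousOn (fun w => (unitCircleMap c R t - w)⁻¹) (spectrum ℂ x) :=
      ContinuousOn.inv₀ (by fun_prop) (hne t)
    rw [cfc_const_mul (deriv (unitCircleMap c R) t) (fun w => f (unitCircleMap c R t) *
      (unitCircleMap c R t - w)⁻¹) x (continuousOn_const.mul h3), cfc_const_mul _ _ x h3,
      cfc_sub_inv_eq_resolvent x (hmem t).2]
  simp_rw [h2] at h1
  rw [← h1]
  refine cfc_congr fun w hw => ?_
  rw [← hh w hw, ← integral_unitCircleMap]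
  rfl

end CfcIntegral

/-! ### Holomorphic calculus in the smooth subalgebra -/

section Smooth

open Complex Metric

variable {𝔄 : Type*} [NonUnitalCStarAlgebra 𝔄] {d c N m : ℝ}

theorem re_le_of_mem_closedBall {a R : ℝ} {z : ℂ} (hz : z ∈ closedBall (a : ℂ) R) : |z.re - a| ≤ R := by
  have := abs_re_le_norm (z - a)
  rw [sub_re, ofReal_re] at this
  exact this.trans (by rwa [mem_closedBall, dist_eq_norm] at hz)

theorem mem_ball_of_real {a R : ℝ} {z : ℂ} (hz : z.im = 0) (h : |z.re - a| < R) :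
    z ∈ ball (a : ℂ) R := by
  have : z - a = ((z.re - a : ℝ) : ℂ) := by apply Complex.ext <;> simp [hz]
  rw [mem_ball, dist_eq_norm, this, norm_real]
  exact h

/-- The contour consists of two circles, one on each side of the line `Re z = m`, around the two
pieces of the spectrum. The function vanishes on the left circle, and on the right one Cauchy's
formula returns the continuous functional calculus. -/
theorem isHolomorphicFunctionOf_onHalfPlane (x : Unitization ℂ 𝔄) [IsStarNormal x]
    (hdm : d < m) (hmc : m < c) (hd : 0 ≤ d) (hc : c ≤ N)
    (hspec : ∀ z ∈ spectrum ℂ x, z.im = 0 ∧ (z.re ∈ Set.Icc 0 d ∨ z.re ∈ Set.Icc c N)) {g : ℂ → ℂ}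
    (hg : DifferentiableOn ℂ g {z | m < z.re}) :
    IsHolomorphicFunctionOf (onHalfPlane m g) x (cfc (onHalfPlane m g) x) := by
  set f := onHalfPlane m g with hf
  have hfd : DifferentiableOn ℂ f {z | z.re ≠ m} := differentiableOn_onHalfPlane hg
  -- The discs meet the real axis in `[(d - m)/2, (d + m)/2]` and `[(c + m)/2, N + (c - m)/2]`. As
  -- `d < m < c`, they contain `[0, d]` and `[c, N]` and stay off the line.
  set c₁ : ℂ := ((d / 2 : ℝ) : ℂ) with hc₁
  set c₂ : ℂ := (((c + N) / 2 : ℝ) : ℂ) with hc₂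
  set R₁ : ℝ := m / 2 with hR₁
  set R₂ : ℝ := (N - m) / 2 with hR₂
  have hR₁0 : 0 ≤ R₁ := by rw [hR₁]; linarith
  have hR₂0 : 0 ≤ R₂ := by rw [hR₂]; linarith
  have hL : ∀ z ∈ closedBall c₁ R₁, z.re < m := fun z hz => by
    have := (abs_le.1 (re_le_of_mem_closedBall hz)).2
    rw [hR₁] at this; linarith
  have hR : ∀ z ∈ closedBall c₂ R₂, m < z.re := fun z hz => by
    have := (abs_le.1 (re_le_of_mem_closedBall hz)).1
    rw [hR₂] at this; linarith
  have hball₁ : ∀ z : ℂ, z.im = 0 → z.re ∈ Set.Icc 0 d → z ∈ ball c₁ R₁ := fun z h1 h2 =>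
    mem_ball_of_real h1 (by rw [abs_lt, hR₁]; constructor <;> linarith [h2.1, h2.2])
  have hball₂ : ∀ z : ℂ, z.im = 0 → z.re ∈ Set.Icc c N → z ∈ ball c₂ R₂ := fun z h1 h2 =>
    mem_ball_of_real h1 (by rw [abs_lt, hR₂]; constructor <;> linarith [h2.1, h2.2])
  have hU₁ : closedBall c₁ R₁ ⊆ {z | z.re ≠ m} := fun z hz => (hL z hz).ne
  have hU₂ : closedBall c₂ R₂ ⊆ {z | z.re ≠ m} := fun z hz => (hR z hz).ne'
  have hmem₁ : ∀ t, unitCircleMap c₁ R₁ t ∈ {z : ℂ | z.re ≠ m} \ spectrum ℂ x := by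
    intro t
    have hs := unitCircleMap_mem_sphere c₁ hR₁0 t
    refine ⟨hU₁ (sphere_subset_closedBall hs), fun hsp => ?_⟩
    obtain ⟨h1, h2 | h2⟩ := hspec _ hsp
    · exact (mem_ball.1 (hball₁ _ h1 h2)).ne (mem_sphere.1 hs)
    · linarith [hL _ (sphere_subset_closedBall hs), h2.1]
  have hmem₂ : ∀ t, unitCircleMap c₂ R₂ t ∈ {z : ℂ | z.re ≠ m} \ spectrum ℂ x := by
    intro t
    have hs := unitCircleMap_mem_sphere c₂ hR₂0 t
    refine ⟨hU₂ (sphere_subset_closedBall hs), fun hsp => ?_⟩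
    obtain ⟨h1, h2 | h2⟩ := hspec _ hsp
    · linarith [hR _ (sphere_subset_closedBall hs), h2.2]
    · exact (mem_ball.1 (hball₂ _ h1 h2)).ne (mem_sphere.1 hs)
  have hone : DifferentiableOn ℂ (fun _ : ℂ => (1 : ℂ)) {z : ℂ | z.re ≠ m} :=
    differentiableOn_const _
  have hpi : (2 * Real.pi * I : ℂ) ≠ 0 := two_pi_I_ne_zero
  refine ⟨{z | z.re ≠ m}, isOpen_re_ne m, fun z hz => ?_, hfd, 2,
    ![unitCircleMap c₁ R₁, unitCircleMap c₂ R₂], ?_, ?_⟩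
  · rcases (hspec z hz).2 with h | h
    · exact (h.2.trans_lt hdm).ne
    · exact (hmc.trans_le h.1).ne'
  · refine ⟨?_, ?_, ?_, ?_, ?_⟩
    · simp [Fin.forall_fin_two, contDiff_unitCircleMap]
    · simp [unitCircleMap, circleMap]
    · simp only [Fin.forall_fin_two]
      exact ⟨fun t _ => hmem₁ t, fun t _ => hmem₂ t⟩
    · intro w hw
      simp only [contourIntegral, Fin.sum_univ_two, Matrix.cons_val_zero, Matrix.cons_val_one]
      rw [integral_unitCircleMap c₁ R₁ fun z => (z - w)⁻¹,
        integral_unitCircleMap c₂ R₂ fun z => (z - w)⁻¹]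
      obtain ⟨h1, h2 | h2⟩ := hspec w hw
      · have e1 := circleIntegral_inv_sub_mul_of_mem hone hU₁ (hball₁ w h1 h2)
        have e2 := circleIntegral_inv_sub_mul_of_notMem hR₂0 hone hU₂ (w := w)
          fun h => by linarith [hR w h, h2.2]
        simp only [one_mul, mul_one] at e1 e2
        rw [e1, e2, add_zero, inv_mul_cancel₀ hpi]
      · have e2 := circleIntegral_inv_sub_mul_of_mem hone hU₂ (hball₂ w h1 h2)
        have e1 := circleIntegral_inv_sub_mul_of_notMem hR₁0 hone hU₁ (w := w)
          fun h => by linarith [hL w h, h2.1]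
        simp only [one_mul, mul_one] at e1 e2
        rw [e1, e2, zero_add, inv_mul_cancel₀ hpi]
    · intro w hw
      have hw : w.re = m := not_not.1 hw
      simp only [contourIntegral, Fin.sum_univ_two, Matrix.cons_val_zero, Matrix.cons_val_one]
      rw [integral_unitCircleMap c₁ R₁ fun z => (z - w)⁻¹,
        integral_unitCircleMap c₂ R₂ fun z => (z - w)⁻¹]
      have e1 := circleIntegral_inv_sub_mul_of_notMem hR₁0 hone hU₁ (w := w)
        fun h => by linarith [hL w h]
      have e2 := circleIntegral_inv_sub_mul_of_notMem hR₂0 hone hU₂ (w := w)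
        fun h => by linarith [hR w h]
      simp only [one_mul] at e1 e2
      rw [e1, e2, add_zero, mul_zero]
  · have hfc : ContinuousOn f (spectrum ℂ x) := hfd.continuousOn.mono fun z hz => by
      rcases (hspec z hz).2 with h | h
      · exact (h.2.trans_lt hdm).ne
      · exact (hmc.trans_le h.1).ne'
    have e2 := integral_smul_resolvent x hfd.continuousOn hmem₂ (h := fun w => 2 * Real.pi * I * f w) (by
      intro w hw
      obtain ⟨h1, h2 | h2⟩ := hspec w hw
      · rw [circleIntegral_inv_sub_mul_of_notMem hR₂0 hfd hU₂ (w := w)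
          fun h => by linarith [hR w h, h2.2], hf, onHalfPlane_of_le g (by linarith [h2.2]), mul_zero]
      · rw [circleIntegral_inv_sub_mul_of_mem hfd hU₂ (hball₂ w h1 h2)])
    have e1 : ∀ t, f (unitCircleMap c₁ R₁ t) = 0 := fun t => onHalfPlane_of_le g
      (hL _ (sphere_subset_closedBall (unitCircleMap_mem_sphere c₁ hR₁0 t))).le
    rw [cfc_const_mul _ _ x hfc] at e2
    simp only [contourIntegral, Fin.sum_univ_two, Matrix.cons_val_zero, Matrix.cons_val_one, e1,
      zero_smul, smul_zero, intervalIntegral.integral_zero, zero_add]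
    rw [e2, smul_smul, inv_mul_cancel₀ hpi, one_smul]

theorem IsSmoothSubalgebra.cfcₙ_onHalfPlane_mem {𝔄₀ : NonUnitalStarSubalgebra ℂ 𝔄}
    (h𝔄₀ : IsSmoothSubalgebra 𝔄₀) {a : 𝔄} (ha : a ∈ 𝔄₀) (hn : IsStarNormal a)
    (hdm : d < m) (hmc : m < c) (hd : 0 ≤ d) (hc : c ≤ N)
    (hspec : ∀ z ∈ quasispectrum ℂ a, z.im = 0 ∧ (z.re ∈ Set.Icc 0 d ∨ z.re ∈ Set.Icc c N))
    {g : ℂ → ℂ} (hg : DifferentiableOn ℂ g {z | m < z.re}) :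
    cfcₙ (onHalfPlane m g) a ∈ 𝔄₀ := by
  rw [Unitization.quasispectrum_eq_spectrum_inr ℂ a] at hspec
  have hn' : IsStarNormal (a : Unitization ℂ 𝔄) := Unitization.isStarNormal_inr.2 hn
  have h := h𝔄₀.holomorphic_stable (a : Unitization ℂ 𝔄) (by simpa using ha) _ _
    (isHolomorphicFunctionOf_onHalfPlane (a : Unitization ℂ 𝔄) hdm hmc hd hc hspec hg)
  rwa [← Unitization.complex_cfcₙ_eq_cfc_inr a _
    (onHalfPlane_of_le g (by simpa using hd.trans hdm.le)), Unitization.snd_inr] at h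

end Smooth

/-! ### Polar decomposition relative to a projection -/

section Polar

open scoped ComplexOrder

variable {B : Type*} [CStarAlgebra B] [PartialOrder B] [StarOrderedRing B]

/-- The function `z ↦ z^{-1/2}` on `Re z > c / 2`, extended by `0`. -/
noncomputable def invSqrt (c : ℝ) : ℂ → ℂ := onHalfPlane (c / 2) fun z => z ^ (-(1 / 2) : ℂ)

theorem differentiableOn_cpow_halfPlane {c : ℝ} (hc : 0 < c) (k : ℂ) :
    DifferentiableOn ℂ (fun z => z ^ k) {z : ℂ | c / 2 < z.re} := fun z hz =>
  ((differentiableAt_id).cpow (differentiableAt_const _)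
    (Or.inl (by have : c / 2 < z.re := hz; simp only [id]; linarith))).differentiableWithinAt

/-- For `S = T* T` one has `S P = S`, so compressing `c P ≤ S` by `S` gives `S³ - c S² ≥ 0`. On the
spectrum `x² (x - c) ≥ 0`: either `x = 0` or `x ≥ c`. -/
theorem mem_spectrum_star_mul_self {T P : B} (hTP : T * P = T) {c : ℝ}
    (hT : (c : ℂ) • P ≤ star T * T) {z : ℂ} (hz : z ∈ spectrum ℂ (star T * T)) :
    z.im = 0 ∧ (z.re = 0 ∨ z.re ∈ Set.Icc c (‖star T * T‖ * ‖(1 : B)‖)) := by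
  set S := star T * T with hS
  have hS0 : 0 ≤ S := star_mul_self_nonneg T
  have hSsa : IsSelfAdjoint S := .of_nonneg hS0
  have hn : IsStarNormal S := hSsa.isStarNormal
  have hSP : S * P = S := by rw [hS, mul_assoc, hTP]
  have h1 : 0 ≤ S * (S - (c : ℂ) • P) * S := hSsa.conjugate_nonneg (sub_nonneg.2 hT)
  have h2 : S * (S - (c : ℂ) • P) * S = cfc (fun z : ℂ => z ^ 3 - c * z ^ 2) S := by
    rw [cfc_sub (fun z : ℂ => z ^ 3) (fun z : ℂ => c * z ^ 2) S,
      cfc_const_mul (c : ℂ) (fun z : ℂ => z ^ 2) S, cfc_pow_id S 3, cfc_pow_id S 2, mul_sub,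
      mul_smul_comm, hSP, sub_mul, smul_mul_assoc]
    congr 1
    · rw [pow_succ, sq]
    · rw [sq]
  rw [h2] at h1
  have h3 := (cfc_nonneg_iff _ S (by fun_prop) hn).1 h1 z hz
  have h4 : 0 ≤ z := by
    have hS1 : 0 ≤ cfc (fun z : ℂ => z) S := by rw [cfc_id' ℂ S]; exact hS0
    exact (cfc_nonneg_iff _ S (by fun_prop) hn).1 hS1 z hz
  obtain ⟨x, hx, rfl⟩ : ∃ x : ℝ, 0 ≤ x ∧ z = (x : ℂ) :=
    ⟨z.re, (Complex.nonneg_iff.1 h4).1, Complex.ext rfl (Complex.nonneg_iff.1 h4).2.symm⟩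
  refine ⟨Complex.ofReal_im x, ?_⟩
  rw [Complex.ofReal_re]
  have h5 : 0 ≤ x ^ 3 - c * x ^ 2 := by
    simp only [← Complex.ofReal_pow, ← Complex.ofReal_mul, ← Complex.ofReal_sub] at h3
    exact_mod_cast h3
  rcases hx.eq_or_lt with h0 | h0
  · exact Or.inl h0.symm
  · refine Or.inr ⟨?_, ?_⟩
    · have : 0 ≤ x ^ 2 * (x - c) := by nlinarith
      linarith [nonneg_of_mul_nonneg_right this (by positivity)]
    · have := spectrum.norm_le_norm_mul_of_mem hz
      rw [Complex.norm_real, Real.norm_of_nonneg hx] at this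
      exact this

/-- Polar decomposition: if `T` vanishes on the complement of the projection `P` and is bounded below
on the range of `P`, then `T (T* T)^{-1/2}` is a partial isometry with initial projection `P`. -/
theorem star_mul_self_polar {T P : B} (hP : IsStarProjection P) (hTP : T * P = T) {c : ℝ}
    (hc : 0 < c) (hT : (c : ℂ) • P ≤ star T * T) :
    star (T * cfc (invSqrt c) (star T * T)) * (T * cfc (invSqrt c) (star T * T)) = P := by
  have hsp := fun z => mem_spectrum_star_mul_self (z := z) hTP hT
  set S := star T * T with hS
  have hS0 : 0 ≤ S := star_mul_self_nonneg T
  have hSsa : IsSelfAdjoint S := .of_nonneg hS0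
  have hSP : S * P = S := by rw [hS, mul_assoc, hTP]
  have hPsa : star P = P := hP.isSelfAdjoint
  have hPS : P * S = S := by
    have := congrArg star hSP
    rwa [star_mul, hPsa, hSsa.star_eq] at this
  have hcont : ∀ k : ℂ, ContinuousOn (onHalfPlane (c / 2) fun z => z ^ k) (spectrum ℂ S) := fun k => by
    refine (differentiableOn_onHalfPlane (differentiableOn_cpow_halfPlane hc k)).continuousOn.mono ?_
    intro z hz
    rcases (hsp z hz).2 with h | h
    · change z.re ≠ c / 2; rw [h]; linarith
    · exact ne_of_gt (by linarith [h.1])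
  have hc1 := hcont (-(1 / 2))
  have hc2 := hcont (-1)
  have hc3 := hcont 0
  -- The exponent `0` makes this the indicator of the nonzero spectrum, so `p` is the support
  -- projection of `S`. The polar part has initial projection `p`, and it remains to see `p = P`.
  set p := cfc (onHalfPlane (c / 2) fun z => z ^ (0 : ℂ)) S with hp
  have hval0 : ∀ {k z : ℂ}, z.re = 0 → onHalfPlane (c / 2) (fun z => z ^ k) z = 0 :=
    fun h => onHalfPlane_of_le _ (by rw [h]; linarith)
  have hval1 : ∀ {k z : ℂ}, c ≤ z.re → onHalfPlane (c / 2) (fun z => z ^ k) z = z ^ k :=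
    fun h => onHalfPlane_of_lt _ (by linarith)
  have hid := cfc_id' ℂ S
  have hne : ∀ {z : ℂ}, c ≤ z.re → z ≠ 0 := by
    rintro z h rfl
    rw [Complex.zero_re] at h; linarith
  have h1 : star (T * cfc (invSqrt c) S) * (T * cfc (invSqrt c) S) = p := by
    have hst : star (cfc (invSqrt c) S) * (S * cfc (invSqrt c) S) = p := by
      have hmul : S * cfc (invSqrt c) S = cfc (fun z => z * invSqrt c z) S := by
        rw [cfc_mul (fun z : ℂ => z) (invSqrt c) S (by fun_prop) hc1, hid]
      rw [hmul, ← cfc_star, ← cfc_mul (fun z => star (invSqrt c z)) (fun z => z * invSqrt c z) S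
        hc1.star ((continuousOn_id).mul hc1)]
      refine cfc_congr fun z hz => ?_
      obtain ⟨him, h | h⟩ := hsp z hz
      · simp only [invSqrt]; rw [hval0 h, hval0 h]; simp
      · simp only [invSqrt]; rw [hval1 h.1, hval1 h.1, Complex.cpow_zero]
        obtain ⟨x, rfl⟩ : ∃ x : ℝ, z = (x : ℂ) := ⟨z.re, Complex.ext rfl him⟩
        have hx : c ≤ x := h.1
        have hx0 : 0 < x := by linarith
        have h5 : (x : ℂ) ^ (-(1 / 2) : ℂ) = ((x ^ (-(1 / 2) : ℝ) : ℝ) : ℂ) := by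
          rw [Complex.ofReal_cpow hx0.le]; push_cast; rfl
        rw [h5, RCLike.star_def, Complex.conj_ofReal, ← Complex.ofReal_mul, ← Complex.ofReal_mul,
          mul_left_comm, ← Real.rpow_add hx0]
        norm_num
        rw [Real.rpow_neg_one]
        exact_mod_cast mul_inv_cancel₀ hx0.ne'
    rw [star_mul, mul_assoc, ← mul_assoc (star T), ← hS, hst]
  have hSp : S * p = S := by
    conv_rhs => rw [← hid]
    rw [hp]
    nth_rw 1 [← hid]
    rw [← cfc_mul (fun z : ℂ => z) _ S (by fun_prop) hc3]
    refine cfc_congr fun z hz => ?_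
    obtain ⟨him, h | h⟩ := hsp z hz
    · have : z = 0 := Complex.ext h him
      simp [this]
    · rw [hval1 h.1, Complex.cpow_zero, mul_one]
  have hpS : ∃ k, p = S * k := by
    refine ⟨cfc (onHalfPlane (c / 2) fun z => z ^ (-1 : ℂ)) S, ?_⟩
    nth_rw 1 [← hid]
    rw [← cfc_mul (fun z : ℂ => z) _ S (by fun_prop) hc2, hp]
    refine cfc_congr fun z hz => ?_
    obtain ⟨him, h | h⟩ := hsp z hz
    · rw [hval0 h, hval0 h, mul_zero]
    · rw [hval1 h.1, hval1 h.1, Complex.cpow_zero, Complex.cpow_neg_one, mul_inv_cancel₀ (hne h.1)]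
  obtain ⟨k, hk⟩ := hpS
  have hPp : P * p = p := by rw [hk, ← mul_assoc, hPS]
  have hpsa : star p = p := by rw [← h1, star_mul, star_star]
  have hq : star (1 - p) = 1 - p := by rw [star_sub, star_one, hpsa]
  -- Since `S (1 - p) = 0`, this compression equals `-c (P (1 - p))* (P (1 - p))`; its positivity
  -- forces `P (1 - p) = 0`.
  have h2 : 0 ≤ star (1 - p) * (S - (c : ℂ) • P) * (1 - p) :=
    star_left_conjugate_nonneg (sub_nonneg.2 hT) _
  have h3 : star (1 - p) * (S - (c : ℂ) • P) * (1 - p) =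
      -((c : ℂ) • (star (P * (1 - p)) * (P * (1 - p)))) := by
    have h4 : S * (1 - p) = 0 := by rw [mul_sub, mul_one, hSp, sub_self]
    have h5 : star (P * (1 - p)) * (P * (1 - p)) = star (1 - p) * (P * (1 - p)) := by
      rw [star_mul, hPsa, mul_assoc, ← mul_assoc P P, hP.isIdempotentElem.eq]
    rw [mul_assoc, sub_mul, h4, zero_sub, h5, smul_mul_assoc, mul_neg, mul_smul_comm]
  rw [h3] at h2
  have h4 : 0 ≤ star (P * (1 - p)) * (P * (1 - p)) := star_mul_self_nonneg _
  have h5 : star (P * (1 - p)) * (P * (1 - p)) = 0 := by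
    refine le_antisymm ?_ h4
    have h6 : (c : ℂ) • (star (P * (1 - p)) * (P * (1 - p))) ≤ 0 := by
      rw [← neg_nonneg]; exact h2
    have h7 : (0 : ℂ) ≤ ((c⁻¹ : ℝ) : ℂ) := by exact_mod_cast (inv_pos.2 hc).le
    have h8 := smul_le_smul_of_nonneg_left h6 h7
    rwa [smul_smul, smul_zero, ← Complex.ofReal_mul, inv_mul_cancel₀ hc.ne', Complex.ofReal_one,
      one_smul] at h8
  have h6 : P * (1 - p) = 0 := CStarRing.star_mul_self_eq_zero_iff _ |>.1 h5
  rw [mul_sub, mul_one, sub_eq_zero, hPp] at h6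
  rw [h1, h6]

omit [PartialOrder B] [StarOrderedRing B] in
theorem mul_eq_self_of_star_mul_self {V P : B} (hP : IsStarProjection P) (hV : star V * V = P) :
    V * P = V := by
  have hPsa : star P = P := hP.isSelfAdjoint
  have hPP : P * P = P := hP.isIdempotentElem
  have h : star (V * P - V) * (V * P - V) = 0 := by
    have e : (P * star V - star V) * (V * P - V) =
        P * (star V * V) * P - P * (star V * V) - ((star V * V) * P - star V * V) := by noncomm_ring
    rw [star_sub, star_mul, hPsa, e, hV, hPP, hPP]
    simp
  exact sub_eq_zero.1 (CStarRing.star_mul_self_eq_zero_iff _ |>.1 h)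

omit [PartialOrder B] [StarOrderedRing B] in
theorem isStarProjection_sub_mul_star {V P Q : B} (hP : IsStarProjection P) (hQ : IsStarProjection Q)
    (hV : star V * V = P) (hQV : Q * V = V) : IsStarProjection (Q - V * star V) := by
  have hVP := mul_eq_self_of_star_mul_self hP hV
  have hQsa : star Q = Q := hQ.isSelfAdjoint
  have hVQ : star V * Q = star V := by
    have := congrArg star hQV
    rwa [star_mul, hQsa] at this
  refine ⟨?_, ?_⟩
  · rw [IsIdempotentElem, sub_mul, mul_sub, mul_sub, hQ.isIdempotentElem.eq, ← mul_assoc Q, hQV,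
      mul_assoc V (star V) Q, hVQ, mul_assoc V (star V), ← mul_assoc (star V) V, hV, ← mul_assoc V, hVP]
    abel
  · rw [IsSelfAdjoint, star_sub, hQsa, star_mul, star_star]

end Polar

/-! ### Bicommutants and comparison of projections by the trace -/

section Trace

variable {H : Type*} [NormedAddCommGroup H] [InnerProductSpace ℂ H] [CompleteSpace H]

theorem mem_bicommutant_iff {B : NonUnitalStarSubalgebra ℂ (H →L[ℂ] H)} {x : H →L[ℂ] H} :
    x ∈ bicommutant B ↔ ∀ Y ∈ Set.centralizer (B : Set (H →L[ℂ] H)), Commute x Y := by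
  rw [← SetLike.mem_coe, coe_bicommutant, Set.mem_centralizer_iff]
  exact forall₂_congr fun Y _ => eq_comm

theorem mem_bicommutant_of_mem {B : NonUnitalStarSubalgebra ℂ (H →L[ℂ] H)} {x : H →L[ℂ] H}
    (hx : x ∈ B) : x ∈ bicommutant B := mem_bicommutant_iff.2 fun _ hY => hY x hx

theorem cfc_mem_bicommutant {B : NonUnitalStarSubalgebra ℂ (H →L[ℂ] H)} {x : H →L[ℂ] H}
    (hx : x ∈ bicommutant B) (hsa : IsSelfAdjoint x) (f : ℂ → ℂ) : cfc f x ∈ bicommutant B := by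
  rw [mem_bicommutant_iff] at hx ⊢
  intro Y hY
  refine Commute.cfc (hx Y hY) ?_ f
  rw [hsa.star_eq]; exact hx Y hY

variable {M : VonNeumannAlgebra H} {τ : (H →L[ℂ] H) → ℝ≥0∞}

/-- Split `Q = V V* + (Q - V V*)` into projections and use `τ (V V*) = τ (V* V)`. -/
theorem IsFaithfulNormalSemifiniteTrace.eq_add (hτ : IsFaithfulNormalSemifiniteTrace M τ)
    {V P Q : H →L[ℂ] H} (hVM : V ∈ M) (hQM : Q ∈ M) (hP : IsStarProjection P)
    (hQ : IsStarProjection Q) (hV : star V * V = P) (hQV : Q * V = V) :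
    τ Q = τ P + τ (Q - V * star V) := by
  have hR := isStarProjection_sub_mul_star hP hQ hV hQV
  have hVV : V * star V ∈ M := mul_mem hVM (star_mem hVM)
  have h := hτ.add _ hVV _ (sub_mem hQM hVV) (mul_star_self_nonneg V) hR.nonneg
  rwa [add_sub_cancel, ← hτ.tracial V hVM, hV] at h

theorem IsFaithfulNormalSemifiniteTrace.le_of_partialIsometry
    (hτ : IsFaithfulNormalSemifiniteTrace M τ)
    {V P Q : H →L[ℂ] H} (hVM : V ∈ M) (hQM : Q ∈ M) (hP : IsStarProjection P)
    (hQ : IsStarProjection Q) (hV : star V * V = P) (hQV : Q * V = V) : τ P ≤ τ Q := by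
  rw [hτ.eq_add hVM hQM hP hQ hV hQV]; exact le_self_add

/-- Finiteness lets `τ P` be cancelled, so the defect `Q - V V*` has trace zero and vanishes by
faithfulness. -/
theorem IsFaithfulNormalSemifiniteTrace.mul_star_self_eq (hτ : IsFaithfulNormalSemifiniteTrace M τ)
    {V P Q : H →L[ℂ] H} (hVM : V ∈ M) (hQM : Q ∈ M) (hP : IsStarProjection P)
    (hQ : IsStarProjection Q) (hV : star V * V = P) (hQV : Q * V = V) (hle : τ Q ≤ τ P)
    (hfin : τ P < ∞) : V * star V = Q := by
  have h := hτ.eq_add hVM hQM hP hQ hV hQV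
  have hR := isStarProjection_sub_mul_star hP hQ hV hQV
  have h0 : τ (Q - V * star V) = 0 := by
    have h1 : τ P + τ (Q - V * star V) ≤ τ P + 0 := by rw [← h, add_zero]; exact hle
    exact le_antisymm ((ENNReal.add_le_add_iff_left hfin.ne).1 h1) (zero_le)
  exact (sub_eq_zero.1 (hτ.faithful _ (sub_mem hQM (mul_mem hVM (star_mem hVM))) hR.nonneg h0)).symm

theorem IsFaithfulNormalSemifiniteTrace.mono (hτ : IsFaithfulNormalSemifiniteTrace M τ)
    {x y : H →L[ℂ] H} (hx : x ∈ M) (hy : y ∈ M) (h0 : 0 ≤ x) (hxy : x ≤ y) : τ x ≤ τ y := by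
  have h := hτ.add x hx (y - x) (sub_mem hy hx) h0 (sub_nonneg.2 hxy)
  rw [add_sub_cancel] at h
  rw [h]; exact le_self_add

end Trace

/-! ### Passing spectral information through the faithful representation -/

section SmoothRepresentation

variable {𝔄 H : Type*} [NonUnitalCStarAlgebra 𝔄] [NormedAddCommGroup H] [InnerProductSpace ℂ H]
  [CompleteSpace H] {π : 𝔄 →⋆ₙₐ[ℂ] (H →L[ℂ] H)} {𝔄₀ : NonUnitalStarSubalgebra ℂ 𝔄}

theorem continuous_of_starHom (π : 𝔄 →⋆ₙₐ[ℂ] (H →L[ℂ] H)) : Continuous π :=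
  AddMonoidHomClass.continuous_of_bound π 1 fun a => by
    simpa using NonUnitalStarAlgHom.norm_apply_le π a

/-- Let `d` be the distance to the quasispectrum of `π a`. Then `π (d(a)) = d(π a) = 0`, so `d(a) =
0` by injectivity and `d` vanishes on the quasispectrum of `a`. -/
theorem quasispectrum_subset_of_injective (hπ : Function.Injective π) (a : 𝔄) [IsStarNormal a] :
    quasispectrum ℂ a ⊆ quasispectrum ℂ (π a) := by
  intro z hz
  set C := quasispectrum ℂ (π a) with hC
  have hn : IsStarNormal (π a) := IsStarNormal.map π a
  have hCc : IsClosed C := (quasispectrum.isCompact (𝕜 := ℂ) (π a)).isClosed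
  have hC0 : (0 : ℂ) ∈ C := quasispectrum.zero_mem ℂ _
  set d : ℂ → ℂ := fun w => (Metric.infDist w C : ℂ) with hd
  have hdc : Continuous d := Complex.continuous_ofReal.comp (Metric.continuous_infDist_pt C)
  have hd0 : d 0 = 0 := by simp [hd, Metric.infDist_zero_of_mem hC0]
  have h1 : π (cfcₙ d a) = 0 := by
    rw [NonUnitalStarAlgHom.map_cfcₙ π d a hdc.continuousOn hd0 (continuous_of_starHom π),
      ← cfcₙ_const_zero ℂ (π a)]
    exact cfcₙ_congr fun w hw => by
      have : Metric.infDist w C = 0 := Metric.infDist_zero_of_mem hw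
      simp [hd, this]
  have h2 : cfcₙ d a = cfcₙ (fun _ : ℂ => (0 : ℂ)) a := by
    rw [cfcₙ_const_zero]; exact hπ (h1.trans (map_zero π).symm)
  have h3 := (cfcₙ_eq_cfcₙ_iff_eqOn (R := ℂ) (inferInstance : IsStarNormal a) hdc.continuousOn hd0
    continuousOn_const rfl).1 h2 hz
  simp only [hd, Complex.ofReal_eq_zero] at h3
  exact (hCc.mem_iff_infDist_zero ⟨0, hC0⟩).2 h3

/-- The form in which smoothness is applied, both to the indicator that yields spectral projections
and to `z^{-1/2}` in the polar decomposition. -/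
theorem exists_map_eq_cfc_onHalfPlane (hπ : Function.Injective π) (h𝔄₀ : IsSmoothSubalgebra 𝔄₀)
    {a : 𝔄} (ha : a ∈ 𝔄₀) (hsa : IsSelfAdjoint (π a)) {d m c N : ℝ}
    (hdm : d < m) (hmc : m < c) (hd : 0 ≤ d) (hc : c ≤ N)
    (hspec : ∀ z ∈ spectrum ℂ (π a), z.im = 0 ∧ (z.re ∈ Set.Icc 0 d ∨ z.re ∈ Set.Icc c N))
    {g : ℂ → ℂ} (hg : DifferentiableOn ℂ g {z | m < z.re}) :
    ∃ b ∈ 𝔄₀, π b = cfc (onHalfPlane m g) (π a) := by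
  have ha' : IsSelfAdjoint a := hπ (by rw [map_star, hsa.star_eq])
  have hn : IsStarNormal a := ha'.isStarNormal
  have hspec' : ∀ z ∈ quasispectrum ℂ (π a),
      z.im = 0 ∧ (z.re ∈ Set.Icc 0 d ∨ z.re ∈ Set.Icc c N) := by
    intro z hz
    rw [quasispectrum_eq_spectrum_union_zero] at hz
    rcases hz with hz | rfl
    · exact hspec z hz
    · exact ⟨rfl, Or.inl ⟨le_rfl, hd⟩⟩
  have h0 : onHalfPlane m g 0 = 0 := onHalfPlane_of_le g (by simpa using hd.trans hdm.le)
  have hsub : quasispectrum ℂ (π a) ⊆ {z | z.re ≠ m} := fun z hz => by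
    rcases (hspec' z hz).2 with h | h
    · exact (h.2.trans_lt hdm).ne
    · exact (hmc.trans_le h.1).ne'
  have hcont := (differentiableOn_onHalfPlane hg).continuousOn
  have hq := quasispectrum_subset_of_injective hπ a
  refine ⟨_, h𝔄₀.cfcₙ_onHalfPlane_mem ha hn hdm hmc hd hc (fun z hz => hspec' z (hq hz)) hg, ?_⟩
  rw [NonUnitalStarAlgHom.map_cfcₙ π _ a (hcont.mono (hq.trans hsub)) h0 (continuous_of_starHom π),
    cfcₙ_eq_cfc (hcont.mono hsub) h0]

end SmoothRepresentation

/-! ### Localization of quadratic forms -/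

section Localization

variable {H : Type*} [NormedAddCommGroup H] [InnerProductSpace ℂ H] {A : H →ₗ.[ℂ] H}

theorem DoubleCommutatorBoundedBy.nonneg {K : H →L[ℂ] H} {γ : ℝ}
    (h : DoubleCommutatorBoundedBy A K γ) : 0 ≤ γ := by
  obtain ⟨-, B, hB, -⟩ := h
  exact (norm_nonneg B).trans hB

variable [CompleteSpace H]

theorem inner_apply_of_isSelfAdjoint {J : H →L[ℂ] H} (hJ : IsSelfAdjoint J) (x y : H) :
    ⟪J x, y⟫_ℂ = ⟪x, J y⟫_ℂ := by
  rw [← ContinuousLinearMap.adjoint_inner_right, ← ContinuousLinearMap.star_eq_adjoint, hJ.star_eq]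

theorem norm_sq_add_norm_sq {J J' : H →L[ℂ] H} (hJ : IsSelfAdjoint J) (hJ' : IsSelfAdjoint J')
    (h : J ^ 2 + J' ^ 2 = 1) (u : H) : ‖J u‖ ^ 2 + ‖J' u‖ ^ 2 = ‖u‖ ^ 2 := by
  have h1 : ⟪J u, J u⟫_ℂ + ⟪J' u, J' u⟫_ℂ = ⟪u, u⟫_ℂ := by
    rw [inner_apply_of_isSelfAdjoint hJ, inner_apply_of_isSelfAdjoint hJ', ← inner_add_right]
    have h2 := congrArg (fun T => T u) h
    simp only [sq] at h2
    congr 1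
  simp only [inner_self_eq_norm_sq_to_K] at h1
  exact_mod_cast h1

/-- Expand `[J, [J, A]] = J² A - 2 J A J + A J²` and take its form at `u`. -/
theorem exists_re_inner_doubleCommutator {J : H →L[ℂ] H} (hJ : IsSelfAdjoint J) {γ : ℝ}
    (hc : DoubleCommutatorBoundedBy A J γ) (u : A.domain) :
    ∃ (h : J u ∈ A.domain) (h2 : J (J u) ∈ A.domain),
      2 * (⟪A ⟨J u, h⟩, J u⟫_ℂ).re ≤ (⟪J (J (A u)), (u : H)⟫_ℂ).re +
        (⟪A ⟨J (J u), h2⟩, (u : H)⟫_ℂ).re + γ * ‖(u : H)‖ ^ 2 := by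
  obtain ⟨hK, B, hB, hBu⟩ := hc
  refine ⟨hK _ u.2, hK _ (hK _ u.2), ?_⟩
  have h1 : B u = J (J (A u) - A ⟨J u, hK _ u.2⟩) -
      (J (A ⟨J u, hK _ u.2⟩) - A ⟨J (J u), hK _ (hK _ u.2)⟩) := hBu u
  have h2 : -(γ * ‖(u : H)‖ ^ 2) ≤ (⟪B u, (u : H)⟫_ℂ).re := by
    have h3 : ‖⟪B u, (u : H)⟫_ℂ‖ ≤ γ * ‖(u : H)‖ ^ 2 := by
      refine (norm_inner_le_norm _ _).trans ?_
      rw [sq, ← mul_assoc]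
      gcongr
      exact (B.le_opNorm _).trans (by gcongr)
    exact (abs_le.1 ((Complex.abs_re_le_norm _).trans h3)).1
  rw [h1] at h2
  simp only [map_sub, inner_sub_left, Complex.sub_re] at h2
  rw [inner_apply_of_isSelfAdjoint hJ (A ⟨J u, hK _ u.2⟩)] at h2
  linarith

/-- The localization formula for the quadratic form of `A`. -/
theorem localization_formula {J J' : H →L[ℂ] H} (hJ : IsSelfAdjoint J) (hJ' : IsSelfAdjoint J')
    (h : J ^ 2 + J' ^ 2 = 1) {γ : ℝ} (hc : DoubleCommutatorBoundedBy A J γ)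
    (hc' : DoubleCommutatorBoundedBy A J' γ) (u : A.domain) :
    ∃ (h1 : J u ∈ A.domain) (h2 : J' u ∈ A.domain),
      (⟪A ⟨J u, h1⟩, J u⟫_ℂ).re + (⟪A ⟨J' u, h2⟩, J' u⟫_ℂ).re ≤
        (⟪A u, (u : H)⟫_ℂ).re + γ * ‖(u : H)‖ ^ 2 := by
  obtain ⟨h1, h2, h3⟩ := exists_re_inner_doubleCommutator hJ hc u
  obtain ⟨h1', h2', h3'⟩ := exists_re_inner_doubleCommutator hJ' hc' u
  refine ⟨h1, h1', ?_⟩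
  have hsum : ∀ v, J (J v) + J' (J' v) = v := fun v => by
    have h2 := congrArg (fun T => T v) h
    simp only [sq] at h2
    exact h2
  have h4 : (⟪J (J (A u)), (u : H)⟫_ℂ).re + (⟪J' (J' (A u)), (u : H)⟫_ℂ).re =
      (⟪A u, (u : H)⟫_ℂ).re := by
    rw [← Complex.add_re, ← inner_add_left, hsum]
  have h5 : (⟪A ⟨J (J u), h2⟩, (u : H)⟫_ℂ).re + (⟪A ⟨J' (J' u), h2'⟩, (u : H)⟫_ℂ).re =
      (⟪A u, (u : H)⟫_ℂ).re := by
    rw [← Complex.add_re, ← inner_add_left, ← LinearPMap.map_add]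
    congr 3
    exact Subtype.ext (hsum u)
  linarith

/-- Insert `(A J' u, J' u) ≥ α ‖J' u‖²` and `‖u‖² = ‖J u‖² + ‖J' u‖²` into the localization formula.
As `α > s + γ`, dropping the `J'` terms gives the first bound; keeping them and using `(A J u, J u)
≥ l ‖J u‖²` gives the second. -/
theorem localization_bound {J J' : H →L[ℂ] H} (hJ : IsSelfAdjoint J) (hJ' : IsSelfAdjoint J')
    (h : J ^ 2 + J' ^ 2 = 1) {γ α l s : ℝ} (hc : DoubleCommutatorBoundedBy A J γ)
    (hc' : DoubleCommutatorBoundedBy A J' γ) (hl : IsBoundedBelowBy A l)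
    (hlower : ∀ u ∈ A.domain, ∀ h : J' u ∈ A.domain,
      α * ‖J' u‖ ^ 2 ≤ (⟪A ⟨J' u, h⟩, J' u⟫_ℂ).re) (hs : s + γ < α) (u : A.domain)
    (hu : (⟪A u, (u : H)⟫_ℂ).re ≤ s * ‖(u : H)‖ ^ 2) :
    ∃ h1 : J u ∈ A.domain, (⟪A ⟨J u, h1⟩, J u⟫_ℂ).re ≤ (s + γ) * ‖J u‖ ^ 2 ∧
      (α - s - γ) * ‖(u : H)‖ ^ 2 ≤ (α - l) * ‖J u‖ ^ 2 := by
  obtain ⟨h1, h2, h3⟩ := localization_formula hJ hJ' h hc hc' u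
  have h4 := norm_sq_add_norm_sq hJ hJ' h (u : H)
  have h5 := hlower u u.2 h2
  have h6 := hl ⟨J u, h1⟩
  simp only at h6
  have h7 : 0 ≤ (α - s - γ) * ‖J' u‖ ^ 2 := mul_nonneg (by linarith) (sq_nonneg _)
  rw [← h4] at h3 hu ⊢
  exact ⟨h1, by linarith, by linarith⟩

variable {H' : Type*} [NormedAddCommGroup H'] [InnerProductSpace ℂ H'] [CompleteSpace H']
  {A' : H' →ₗ.[ℂ] H'}

/-- The spectral projection of `A'` is bounded below on the image under `B` of the vectors `u` with
`(A u, u) ≤ s ‖u‖²`. -/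
theorem exists_lower_bound_spectralProjection {J J' : H →L[ℂ] H} (hJ : IsSelfAdjoint J)
    (hJ' : IsSelfAdjoint J') (h : J ^ 2 + J' ^ 2 = 1) {γ α l l' s β ε μ : ℝ}
    (hc : DoubleCommutatorBoundedBy A J γ) (hc' : DoubleCommutatorBoundedBy A J' γ)
    (hl : IsBoundedBelowBy A l) (hlα : l < α)
    (hlower : ∀ u ∈ A.domain, ∀ h : J' u ∈ A.domain,
      α * ‖J' u‖ ^ 2 ≤ (⟪A ⟨J' u, h⟩, J' u⟫_ℂ).re) (hs : s + γ < α)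
    (hA' : IsSelfAdjoint A') (hl' : IsBoundedBelowBy A' l') {B : H →L[ℂ] H'}
    (hB : ∀ u, ‖B u‖ = ‖J u‖) (hβ : 0 ≤ β)
    (hform : ∀ u : H, ∀ h1 : J u ∈ A.domain, ∃ h2 : B u ∈ A'.domain,
      (⟪A' ⟨B u, h2⟩, B u⟫_ℂ).re ≤ β * (⟪A ⟨J u, h1⟩, J u⟫_ℂ).re + ε * ‖J u‖ ^ 2)
    (hμ : β * (s + γ) + ε < μ) :
    ∃ c : ℝ, 0 < c ∧ ∀ u : A.domain, (⟪A u, (u : H)⟫_ℂ).re ≤ s * ‖(u : H)‖ ^ 2 →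
      c * ‖(u : H)‖ ^ 2 ≤ ‖spectralProjection A' μ (B u)‖ ^ 2 := by
  set κ := β * (s + γ) + ε with hκ
  -- The maximum with `1` only keeps the denominator positive. The constant below multiplies the
  -- share of `‖B u‖²` kept by the projection by the share of `‖u‖²` kept by `J`.
  set k := max (μ - l') 1 with hk
  have hk0 : 0 < k := lt_max_of_lt_right one_pos
  refine ⟨(μ - κ) / k * ((α - s - γ) / (α - l)), ?_, fun u hu => ?_⟩
  · exact mul_pos (div_pos (by linarith) hk0) (div_pos (by linarith) (by linarith))
  · obtain ⟨h1, h2, h3⟩ := localization_bound hJ hJ' h hc hc' hl hlower hs u hu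
    obtain ⟨h4, h5⟩ := hform u h1
    have h6 := spectralProjection_lower_bound (r := μ) hA' hl' ⟨B u, h4⟩
    simp only at h6
    have h7 : (⟪A' ⟨B u, h4⟩, B u⟫_ℂ).re ≤ κ * ‖B u‖ ^ 2 := by
      rw [hB]
      have := mul_le_mul_of_nonneg_left h2 hβ
      rw [hκ]; linarith
    have h8 : (μ - κ) * ‖B u‖ ^ 2 ≤ k * ‖spectralProjection A' μ (B u)‖ ^ 2 := by
      have := mul_le_mul_of_nonneg_right (le_max_left (μ - l') 1)
        (sq_nonneg ‖spectralProjection A' μ (B u)‖)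
      rw [← hk] at this
      linarith
    have h9 : (α - s - γ) / (α - l) * ‖(u : H)‖ ^ 2 ≤ ‖B u‖ ^ 2 := by
      rw [hB, div_mul_eq_mul_div, div_le_iff₀ (by linarith)]; linarith
    calc (μ - κ) / k * ((α - s - γ) / (α - l)) * ‖(u : H)‖ ^ 2
        = (μ - κ) / k * ((α - s - γ) / (α - l) * ‖(u : H)‖ ^ 2) := by ring
      _ ≤ (μ - κ) / k * ‖B u‖ ^ 2 :=
          mul_le_mul_of_nonneg_left h9 (div_pos (by linarith) hk0).le
      _ ≤ ‖spectralProjection A' μ (B u)‖ ^ 2 := by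
          rw [div_mul_eq_mul_div, div_le_iff₀ hk0]; linarith

theorem norm_apply_eq_of_adjoint_comp {J : H →L[ℂ] H} (hJ : IsSelfAdjoint J) {B : H →L[ℂ] H'}
    (h : ∀ u, ContinuousLinearMap.adjoint B (B u) = J (J u)) (u : H) : ‖B u‖ = ‖J u‖ := by
  have h1 : ⟪B u, B u⟫_ℂ = ⟪J u, J u⟫_ℂ := by
    rw [← ContinuousLinearMap.adjoint_inner_right, h, inner_apply_of_isSelfAdjoint hJ]
  simp only [inner_self_eq_norm_sq_to_K] at h1
  have h2 : ‖B u‖ ^ 2 = ‖J u‖ ^ 2 := by exact_mod_cast h1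
  exact (sq_eq_sq₀ (norm_nonneg _) (norm_nonneg _)).1 h2

end Localization

/-! ### From lower bounds to Murray–von Neumann equivalence -/

section Equivalence

variable {𝔄 H : Type*} [NonUnitalCStarAlgebra 𝔄] [NormedAddCommGroup H] [InnerProductSpace ℂ H]
  [CompleteSpace H] {π : 𝔄 →⋆ₙₐ[ℂ] (H →L[ℂ] H)} {𝔄₀ : NonUnitalStarSubalgebra ℂ 𝔄}

theorem smul_le_star_mul_self {T P : H →L[ℂ] H} (hP : IsStarProjection P) {c : ℝ}
    (h : ∀ x, c * ‖P x‖ ^ 2 ≤ ‖T x‖ ^ 2) : (c : ℂ) • P ≤ star T * T := by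
  rw [ContinuousLinearMap.le_def, ContinuousLinearMap.isPositive_def']
  refine ⟨(IsSelfAdjoint.star_mul_self T).sub ?_, fun x => ?_⟩
  · rw [IsSelfAdjoint, star_smul, hP.isSelfAdjoint.star_eq, RCLike.star_def, Complex.conj_ofReal]
  · have h1 : ⟪P x, x⟫_ℂ = ⟪P x, P x⟫_ℂ := by
      rw [← inner_apply_of_isSelfAdjoint hP.isSelfAdjoint (P x) x]
      exact congrArg (fun T => ⟪T x, x⟫_ℂ) hP.isIdempotentElem.eq.symm
    have h2 : ⟪(star T * T) x, x⟫_ℂ = ⟪T x, T x⟫_ℂ := by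
      rw [mul_apply_eq_comp, ContinuousLinearMap.star_eq_adjoint,
        ContinuousLinearMap.adjoint_inner_left]
    rw [ContinuousLinearMap.reApplyInnerSelf_apply, sub_apply, smul_apply, inner_sub_left,
      inner_smul_left, h1, h2, inner_self_eq_norm_sq_to_K, inner_self_eq_norm_sq_to_K]
    have := h x
    simp only [Complex.conj_ofReal, RCLike.re_eq_complex_re, Complex.coe_algebraMap,
      ← Complex.ofReal_pow, ← Complex.ofReal_mul, ← Complex.ofReal_sub, Complex.ofReal_re]
    linarith

/-- The polar part of `T` stays in the von Neumann algebra and carries `P` onto a subprojection of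
`Q`. -/
theorem IsFaithfulNormalSemifiniteTrace.le_of_lower_bound {C : NonUnitalStarSubalgebra ℂ (H →L[ℂ] H)}
    {τ : (H →L[ℂ] H) → ℝ≥0∞} (hτ : IsFaithfulNormalSemifiniteTrace (bicommutant C) τ)
    {T P Q : H →L[ℂ] H} (hTM : T ∈ bicommutant C) (hQM : Q ∈ bicommutant C)
    (hP : IsStarProjection P) (hQ : IsStarProjection Q) (hTP : T * P = T) (hQT : Q * T = T) {c : ℝ}
    (hc : 0 < c) (h : ∀ x, c * ‖P x‖ ^ 2 ≤ ‖T x‖ ^ 2) : τ P ≤ τ Q := by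
  have hV := star_mul_self_polar hP hTP hc (smul_le_star_mul_self hP h)
  have hk := cfc_mem_bicommutant (mul_mem (star_mem hTM) hTM) (IsSelfAdjoint.star_mul_self T)
    (invSqrt c)
  exact hτ.le_of_partialIsometry (mul_mem hTM hk) hQM hP hQ hV (by rw [← mul_assoc, hQT])

/-- The intertwiner `t` is only in `𝔄`. It is replaced by a nearby `x = q x₀ p` in `𝔄₀`, still
bounded below on the range of `P`; then `x* x` has a spectral gap above `0` and its inverse square
root lies in `𝔄₀`. -/
theorem murrayVonNeumannEquivalentIn_of_lower_bound (hπ : Function.Injective π)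
    (h𝔄₀ : IsSmoothSubalgebra 𝔄₀) {τ : (H →L[ℂ] H) → ℝ≥0∞}
    (hτ : IsFaithfulNormalSemifiniteTrace (bicommutant (NonUnitalStarAlgHom.range π)) τ)
    {P Q : H →L[ℂ] H} (hP : IsStarProjection P) (hQ : IsStarProjection Q)
    (hPm : P ∈ 𝔄₀.map π) (hQm : Q ∈ 𝔄₀.map π) {t : 𝔄} (htP : π t * P = π t) (hQt : Q * π t = π t)
    {c : ℝ} (hc : 0 < c) (h : ∀ x, c * ‖P x‖ ^ 2 ≤ ‖π t x‖ ^ 2) (hle : τ Q ≤ τ P)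
    (hfin : τ P < ∞) : MurrayVonNeumannEquivalentIn (𝔄₀.map π) P Q := by
  refine ⟨⟨hPm, hP⟩, ⟨hQm, hQ⟩, ?_⟩
  obtain ⟨p, hp, hpP⟩ := NonUnitalStarSubalgebra.mem_map.1 hPm
  obtain ⟨q, hq, hqQ⟩ := NonUnitalStarSubalgebra.mem_map.1 hQm
  -- Then `‖π t y‖ ≥ 2δ ‖P y‖`, and an approximation within `δ` loses only half of this.
  set δ := Real.sqrt c / 2 with hδ
  have hδ0 : 0 < δ := by positivity
  have hcδ : c = (2 * δ) ^ 2 := by rw [hδ, mul_div_cancel₀ _ two_ne_zero, Real.sq_sqrt hc.le]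
  obtain ⟨x₀, hx₀, hdist⟩ := h𝔄₀.dense.exists_dist_lt t hδ0
  set x := q * x₀ * p with hx
  have hxm : x ∈ 𝔄₀ := mul_mem (mul_mem hq hx₀) hp
  have hπx : π x = Q * π x₀ * P := by rw [hx, map_mul, map_mul, hpP, hqQ]
  have hxP : π x * P = π x := by rw [hπx, mul_assoc, hP.isIdempotentElem.eq]
  have hQx : Q * π x = π x := by
    rw [hπx, ← mul_assoc, ← mul_assoc, hQ.isIdempotentElem.eq]
  have hdiff : π t - π x = Q * π (t - x₀) * P := by
    rw [hπx, map_sub, mul_sub, sub_mul, hQt, htP]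
  have hQ1 : ‖Q‖ ≤ 1 := hQ.norm_le
  have hbound : ∀ y, δ ^ 2 * ‖P y‖ ^ 2 ≤ ‖π x y‖ ^ 2 := by
    intro y
    have h1 : 2 * δ * ‖P y‖ ≤ ‖π t y‖ := by
      refine (sq_le_sq₀ (by positivity) (norm_nonneg _)).1 ?_
      rw [mul_pow, ← hcδ]; exact h y
    have h2 : ‖π t y - π x y‖ ≤ δ * ‖P y‖ := by
      have h3 : π t y - π x y = Q (π (t - x₀) (P y)) := congrArg (fun T => T y) hdiff
      rw [h3]
      have h4 : ‖π (t - x₀)‖ ≤ δ :=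
        (NonUnitalStarAlgHom.norm_apply_le π _).trans (by rw [← dist_eq_norm]; exact hdist.le)
      calc ‖Q (π (t - x₀) (P y))‖ ≤ ‖Q‖ * ‖π (t - x₀) (P y)‖ := Q.le_opNorm _
        _ ≤ 1 * ‖π (t - x₀) (P y)‖ := by gcongr
        _ = ‖π (t - x₀) (P y)‖ := one_mul _
        _ ≤ ‖π (t - x₀)‖ * ‖P y‖ := ContinuousLinearMap.le_opNorm _ _
        _ ≤ δ * ‖P y‖ := by gcongr
    have h3 : δ * ‖P y‖ ≤ ‖π x y‖ := by
      have := norm_le_norm_add_norm_sub' (π t y) (π x y)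
      linarith
    rw [← mul_pow]
    gcongr
  have hδ2 : 0 < δ ^ 2 := by positivity
  have hle2 := smul_le_star_mul_self hP hbound
  have hV := star_mul_self_polar hP hxP hδ2 hle2
  have hS : π (star x * x) = star (π x) * π x := by rw [map_mul, map_star]
  have hsp : ∀ z ∈ spectrum ℂ (π (star x * x)), z.im = 0 ∧ (z.re ∈ Set.Icc 0 0 ∨
      z.re ∈ Set.Icc (δ ^ 2) (max (δ ^ 2) (‖star (π x) * π x‖ * ‖(1 : H →L[ℂ] H)‖))) := by
    rw [hS]
    intro z hz
    obtain ⟨h1, h2 | h2⟩ := mem_spectrum_star_mul_self hxP hle2 hz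
    · exact ⟨h1, Or.inl ⟨h2.ge, h2.le⟩⟩
    · exact ⟨h1, Or.inr ⟨h2.1, h2.2.trans (le_max_right _ _)⟩⟩
  -- The lower part of the spectrum is just `{0}`, so the separating line may be at `δ² / 2`, as in
  -- `invSqrt (δ ^ 2)`.
  obtain ⟨k, hk, hπk⟩ := exists_map_eq_cfc_onHalfPlane hπ h𝔄₀ (mul_mem (star_mem hxm) hxm)
    (by rw [hS]; exact IsSelfAdjoint.star_mul_self _) (half_pos hδ2) (half_lt_self hδ2) le_rfl
    (le_max_left _ _) hsp (differentiableOn_cpow_halfPlane hδ2 (-(1 / 2)))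
  have hVk : π (x * k) = π x * cfc (invSqrt (δ ^ 2)) (star (π x) * π x) := by
    rw [map_mul, hπk, hS]; rfl
  have hmem : ∀ a : 𝔄, π a ∈ bicommutant (NonUnitalStarAlgHom.range π) := fun a =>
    mem_bicommutant_of_mem ⟨a, rfl⟩
  rw [← hVk] at hV
  refine ⟨π (x * k), NonUnitalStarSubalgebra.mem_map.2 ⟨_, mul_mem hxm hk, rfl⟩, hV, ?_⟩
  exact hτ.mul_star_self_eq (hmem _) (hqQ ▸ hmem q) hP hQ hV
    (by rw [map_mul, ← mul_assoc, hQx]) hle hfin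

variable {K : Type*} [NormedAddCommGroup K] [InnerProductSpace ℂ K] [CompleteSpace K]
  {A : K →ₗ.[ℂ] K} {l r s : ℝ}

theorem conj_spectralProjection_mem_map (hπ : Function.Injective π) (h𝔄₀ : IsSmoothSubalgebra 𝔄₀)
    (V : K ≃ₗᵢ[ℂ] H) (hA : IsSelfAdjoint A) (hl : IsBoundedBelowBy A l)
    (hheat : ∃ a ∈ 𝔄₀, π a = V.conjStarAlgEquiv (heatOperator A 1)) (h : r < s)
    (hgap : ∀ x ∈ Set.Ioo r s, ¬ InSpectrum A x) :
    V.conjStarAlgEquiv (spectralProjection A r) ∈ 𝔄₀.map π := by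
  obtain ⟨a, ha, hπa⟩ := hheat
  have hexp : Real.exp (-s) < Real.exp (-r) := Real.exp_lt_exp.2 (by linarith)
  obtain ⟨m, hm1, hm2⟩ := exists_between hexp
  have hK := isSelfAdjoint_heatOperator A 1
  have hspec : ∀ z ∈ spectrum ℂ (heatOperator A 1), z.im = 0 ∧
      (z.re ∈ Set.Icc 0 (Real.exp (-s)) ∨
        z.re ∈ Set.Icc (Real.exp (-r)) (max (Real.exp (-r)) (Real.exp (-l)))) := fun z hz =>
    (mem_spectrum_heatOperator_of_gap hA hl hgap hz).imp_right
      (Or.imp_right fun h => ⟨h.1, h.2.trans (le_max_right _ _)⟩)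
  have hspec' : spectrum ℂ (π a) = spectrum ℂ (heatOperator A 1) := by
    rw [hπa]; exact AlgEquiv.spectrum_eq V.conjStarAlgEquiv _
  have hsa : IsSelfAdjoint (π a) := by rw [hπa]; exact hK.map V.conjStarAlgEquiv
  obtain ⟨b, hb, hπb⟩ := exists_map_eq_cfc_onHalfPlane hπ h𝔄₀ ha hsa hm1 hm2 (Real.exp_pos _).le
    (le_max_left _ _) (by rw [hspec']; exact hspec)
    (differentiableOn_const (1 : ℂ) (s := {z : ℂ | m < z.re}))
  refine NonUnitalStarSubalgebra.mem_map.2 ⟨b, hb, ?_⟩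
  have hcont : ContinuousOn (onHalfPlane m fun _ => 1) (spectrum ℂ (heatOperator A 1)) := by
    refine (differentiableOn_onHalfPlane (differentiableOn_const _)).continuousOn.mono fun z hz => ?_
    rcases (hspec z hz).2 with h1 | h1
    · exact (h1.2.trans_lt hm1).ne
    · exact (hm2.trans_le h1.1).ne'
  have hΦ : Continuous V.conjStarAlgEquiv :=
    AddMonoidHomClass.continuous_of_bound V.conjStarAlgEquiv 1 fun x => by
      rw [one_mul]
      exact NonUnitalStarAlgHom.norm_apply_le V.conjStarAlgEquiv x
  have hn : IsStarNormal (heatOperator A 1) := hK.isStarNormal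
  have hn' : IsStarNormal (V.conjStarAlgEquiv (heatOperator A 1)) := by
    rw [← hπa]; exact hsa.isStarNormal
  rw [hπb, hπa, spectralProjection_eq_cfc_heatOperator hA hl h hgap ⟨hm1, hm2⟩]
  exact (StarAlgHomClass.map_cfc V.conjStarAlgEquiv _ _ hcont hΦ hn hn').symm

/-- Valid for every `r`, gap or not: this gives `τ` access to all the projections `Q s` before a gap
of `A₂` is known. -/
theorem conj_spectralProjection_mem_bicommutant (V : K ≃ₗᵢ[ℂ] H) (hA : IsSelfAdjoint A)
    (hl : IsBoundedBelowBy A l) (hheat : ∃ a, π a = V.conjStarAlgEquiv (heatOperator A 1)) :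
    V.conjStarAlgEquiv (spectralProjection A r) ∈ bicommutant (NonUnitalStarAlgHom.range π) := by
  obtain ⟨a, hπa⟩ := hheat
  refine mem_bicommutant_iff.2 fun Y hY => ?_
  have h1 : Commute (V.conjStarAlgEquiv (heatOperator A 1)) Y := by
    rw [← hπa]; exact hY _ ⟨a, rfl⟩
  have h2 : Commute (heatOperator A 1) (V.conjStarAlgEquiv.symm Y) := by
    have := h1.map V.conjStarAlgEquiv.symm
    rwa [StarAlgEquiv.symm_apply_apply] at this
  have h3 := (commute_spectralProjection (r := r) hA hl h2).map V.conjStarAlgEquiv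
  rwa [StarAlgEquiv.apply_symm_apply] at h3

theorem trace_conj_spectralProjection_lt_top {C : NonUnitalStarSubalgebra ℂ (H →L[ℂ] H)}
    {τ : (H →L[ℂ] H) → ℝ≥0∞} (hτ : IsFaithfulNormalSemifiniteTrace (bicommutant C) τ)
    (V : K ≃ₗᵢ[ℂ] H) (hA : IsSelfAdjoint A) (hl : IsBoundedBelowBy A l)
    (hPm : V.conjStarAlgEquiv (spectralProjection A r) ∈ bicommutant C)
    (hKm : V.conjStarAlgEquiv (heatOperator A 1) ∈ bicommutant C)
    (hfin : τ (V.conjStarAlgEquiv (heatOperator A 1)) < ∞) :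
    τ (V.conjStarAlgEquiv (spectralProjection A r)) < ∞ := by
  set P := V.conjStarAlgEquiv (spectralProjection A r) with hP
  have hPp : IsStarProjection P := (isStarProjection_spectralProjection A r).map V.conjStarAlgEquiv
  set k : ℝ≥0 := ⟨Real.exp (-r), (Real.exp_pos _).le⟩ with hk
  have hle : ((k : ℝ) : ℂ) • P ≤ V.conjStarAlgEquiv (heatOperator A 1) := by
    have := OrderHomClass.mono V.conjStarAlgEquiv
      (smul_spectralProjection_le_heatOperator (r := r) hA hl)
    rwa [map_smul] at this
  have h0 : 0 ≤ ((k : ℝ) : ℂ) • P := by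
    have h1 : ((k : ℝ) : ℂ) • P = star (((Real.exp (-r / 2) : ℝ) : ℂ) • P) *
        (((Real.exp (-r / 2) : ℝ) : ℂ) • P) := by
      rw [star_smul, hPp.isSelfAdjoint.star_eq, smul_mul_smul_comm, hPp.isIdempotentElem.eq,
        RCLike.star_def, Complex.conj_ofReal, ← Complex.ofReal_mul, ← Real.exp_add]
      congr 3
      change Real.exp (-r) = _
      congr 1; ring
    rw [h1]; exact star_mul_self_nonneg _
  have hm : ((k : ℝ) : ℂ) • P ∈ bicommutant C := (bicommutant C).toStarSubalgebra.smul_mem hPm _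
  have h1 := (hτ.mono hm hKm h0 hle).trans_lt hfin
  rw [hτ.smul k P hPm hPp.nonneg] at h1
  refine ENNReal.lt_top_of_mul_ne_top_right h1.ne ?_
  simp only [ne_eq, ENNReal.coe_eq_zero]
  intro h
  exact (Real.exp_pos (-r)).ne' (congrArg NNReal.toReal h)

end Equivalence

/-! ### Arithmetic of the interval endpoints -/

section Bounds

/-- As `a₂ ≥ 0` and `ρ > 0`, the bracket multiplied by `ρ` is nonnegative, so `ρ > 1` only enlarges
it; the quotient inside is nonnegative and may be dropped. -/
theorem form_bound_le_upper {a₁ a₂ l₁ α₁ β₁ γ₁ ε₁ ρ : ℝ} (hρ : 1 < ρ) (hβ₁ : 1 ≤ β₁)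
    (hα₁ : a₁ + γ₁ < α₁)
    (ha₂ : a₂ = ρ * (β₁ * (a₁ + γ₁ + (a₁ + γ₁ - l₁) ^ 2 / (α₁ - a₁ - γ₁)) + ε₁)) (h0 : 0 ≤ a₂) :
    β₁ * (a₁ + γ₁) + ε₁ ≤ a₂ := by
  set q := (a₁ + γ₁ - l₁) ^ 2 / (α₁ - a₁ - γ₁) with hq
  have hq0 : 0 ≤ q := div_nonneg (sq_nonneg _) (by linarith)
  set S := β₁ * (a₁ + γ₁ + q) + ε₁ with hS
  have hS0 : 0 ≤ S := by
    by_contra h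
    have := mul_neg_of_pos_of_neg (zero_lt_one.trans hρ) (not_le.1 h)
    linarith
  have h1 : S ≤ ρ * S := le_mul_of_one_le_left hS0 hρ.le
  have h2 : 0 ≤ β₁ * q := by positivity
  rw [hS, mul_add] at h1
  linarith

/-- With `x = b₂ + γ₂` and `κ = β₂⁻¹ (b₁ ρ⁻¹ - ε₂)`, clearing the denominator turns the formula for
`b₂` into `(x - l₂)² = (κ - x)(α₂ - x)`. As `x < α₂`, this gives `x ≤ κ`. -/
theorem form_bound_le_lower {b₁ b₂ l₂ α₂ β₂ γ₂ ε₂ ρ : ℝ} (hρ : 1 < ρ) (hβ₂ : 1 ≤ β₂) (hε₂ : 0 < ε₂)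
    (hγ₂ : 0 ≤ γ₂) (hα₂ : b₂ + γ₂ < α₂)
    (hb₂ : b₂ = (β₂⁻¹ * (b₁ * ρ⁻¹ - ε₂) * (α₂ - γ₂) - α₂ * γ₂ + 2 * l₂ * γ₂ - l₂ ^ 2) /
      (α₂ - 2 * l₂ + β₂⁻¹ * (b₁ * ρ⁻¹ - ε₂))) (h0 : 0 < b₂) :
    β₂ * (b₂ + γ₂) + ε₂ ≤ b₁ := by
  have hβ0 : 0 < β₂ := zero_lt_one.trans_le hβ₂
  set κ := β₂⁻¹ * (b₁ * ρ⁻¹ - ε₂) with hκ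
  -- A zero denominator would make `b₂ = 0` by the convention for division.
  have hD : α₂ - 2 * l₂ + κ ≠ 0 := by
    intro h
    rw [h, div_zero] at hb₂
    exact h0.ne' hb₂
  rw [eq_div_iff hD] at hb₂
  set x := b₂ + γ₂ with hx
  have h1 : (x - l₂) ^ 2 = (κ - x) * (α₂ - x) := by rw [hx]; linear_combination hb₂
  have h2 : x ≤ κ := by
    have := nonneg_of_mul_nonneg_left (h1 ▸ sq_nonneg (x - l₂)) (sub_pos.2 hα₂)
    linarith
  have h3 : β₂ * κ = b₁ * ρ⁻¹ - ε₂ := by rw [hκ, ← mul_assoc, mul_inv_cancel₀ hβ0.ne', one_mul]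
  have h4 : β₂ * x + ε₂ ≤ b₁ * ρ⁻¹ := by
    have := mul_le_mul_of_nonneg_left h2 hβ0.le
    linarith
  have h5 : 0 < b₁ * ρ⁻¹ := by
    have : 0 ≤ β₂ * x := mul_nonneg hβ0.le (by linarith)
    linarith
  have hρ0 : 0 < ρ⁻¹ := inv_pos.2 (zero_lt_one.trans hρ)
  have h6 : 0 < b₁ := pos_of_mul_pos_left h5 hρ0.le
  have h7 : b₁ * ρ⁻¹ ≤ b₁ := mul_le_of_le_one_right h6.le (inv_le_one_of_one_le₀ hρ.le)
  linarith

end Bounds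

end SpectralEquiv

/-! ### The main theorem -/

theorem theoremt
    {𝔄 H H₀ H₁ H₂ : Type*} [NonUnitalCStarAlgebra 𝔄]
    [NormedAddCommGroup H] [InnerProductSpace ℂ H] [CompleteSpace H]
    [NormedAddCommGroup H₀] [InnerProductSpace ℂ H₀] [CompleteSpace H₀]
    [NormedAddCommGroup H₁] [InnerProductSpace ℂ H₁] [CompleteSpace H₁]
    [NormedAddCommGroup H₂] [InnerProductSpace ℂ H₂] [CompleteSpace H₂]
    -- the faithful representation of the C*-algebra and the unitary identifications
    (π : 𝔄 →⋆ₙₐ[ℂ] (H →L[ℂ] H)) (hπ : Function.Injective π)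
    (V₁ : H₁ ≃ₗᵢ[ℂ] H) (V₂ : H₂ ≃ₗᵢ[ℂ] H)
    -- the smooth subalgebra
    (𝔄₀ : NonUnitalStarSubalgebra ℂ 𝔄) (h𝔄₀ : IsSmoothSubalgebra 𝔄₀)
    -- the self-adjoint operators, bounded below
    (A₁ : H₁ →ₗ.[ℂ] H₁) (A₂ : H₂ →ₗ.[ℂ] H₂)
    (hA₁ : IsSelfAdjoint A₁) (hA₂ : IsSelfAdjoint A₂)
    (l₁ l₂ : ℝ) (hl₁ : l₁ ≤ 0) (hl₂ : l₂ ≤ 0)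
    (hbelow₁ : IsBoundedBelowBy A₁ l₁) (hbelow₂ : IsBoundedBelowBy A₂ l₂)
    -- the heat operators lie in the smooth subalgebra
    (hheat₁ : ∀ t : ℝ, 0 < t → ∃ a ∈ 𝔄₀, π a = V₁.conjStarAlgEquiv (heatOperator A₁ t))
    (hheat₂ : ∀ t : ℝ, 0 < t → ∃ a ∈ 𝔄₀, π a = V₂.conjStarAlgEquiv (heatOperator A₂ t))
    -- the trace, finite on the heat operators
    (τ : (H →L[ℂ] H) → ℝ≥0∞)
    (hτ : IsFaithfulNormalSemifiniteTrace (bicommutant (NonUnitalStarAlgHom.range π)) τ)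
    (hτ₁ : ∀ t : ℝ, 0 < t → τ (V₁.conjStarAlgEquiv (heatOperator A₁ t)) < ∞)
    (hτ₂ : ∀ t : ℝ, 0 < t → τ (V₂.conjStarAlgEquiv (heatOperator A₂ t)) < ∞)
    -- the auxiliary space and the maps that connect it with `H₁` and `H₂`
    (i₁ : H₀ →L[ℂ] H₁) (i₂ : H₀ →L[ℂ] H₂) (p₁ : H₁ →L[ℂ] H₀) (p₂ : H₂ →L[ℂ] H₀)
    (hpi₁ : p₁ ∘L i₁ = ContinuousLinearMap.id ℂ H₀)
    (hpi₂ : p₂ ∘L i₂ = ContinuousLinearMap.id ℂ H₀)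
    (J : H₀ →L[ℂ] H₀) (hJ : IsSelfAdjoint J)
    (hJ_mem : (V₂ : H₂ →L[ℂ] H) ∘L (i₂ ∘L J ∘L p₁) ∘L (V₁.symm : H →L[ℂ] H₁) ∈
      bicommutant (NonUnitalStarAlgHom.range π))
    (hJ_adj : ContinuousLinearMap.adjoint (i₂ ∘L J ∘L p₁) = i₁ ∘L J ∘L p₂)
    (hJ_mul : ∀ a : 𝔄, ∃ b : 𝔄,
      π b = π a * ((V₂ : H₂ →L[ℂ] H) ∘L (i₂ ∘L J ∘L p₁) ∘L (V₁.symm : H →L[ℂ] H₁)))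
    (ρ : ℝ) (hρ : 1 < ρ)
    (hρ_le : ∀ u : H₀, ρ⁻¹ * ‖i₂ (J u)‖ ≤ ‖i₁ (J u)‖ ∧ ‖i₁ (J u)‖ ≤ ρ * ‖i₂ (J u)‖)
    -- the operators `J_l = i_l J p_l` and `J'_l = (1 - J_l²)^{1/2}`
    (J₁ J₁' : H₁ →L[ℂ] H₁) (J₂ J₂' : H₂ →L[ℂ] H₂)
    (hJ₁ : J₁ = i₁ ∘L J ∘L p₁) (hJ₂ : J₂ = i₂ ∘L J ∘L p₂)
    (hJ₁_nonneg : 0 ≤ J₁) (hJ₁_le : J₁ ≤ 1) (hJ₂_nonneg : 0 ≤ J₂) (hJ₂_le : J₂ ≤ 1)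
    (hJ₁'_nonneg : 0 ≤ J₁') (hJ₁' : J₁ ^ 2 + J₁' ^ 2 = 1)
    (hJ₂'_nonneg : 0 ≤ J₂') (hJ₂' : J₂ ^ 2 + J₂' ^ 2 = 1)
    (hdom : ∀ u : H₀, i₁ (J u) ∈ A₁.domain ↔ i₂ (J u) ∈ A₂.domain)
    -- `J_l` and `J'_l` preserve the domain and have bounded double commutators with `A_l`
    (γ₁ γ₂ : ℝ)
    (hcomm₁ : DoubleCommutatorBoundedBy A₁ J₁ γ₁) (hcomm₁' : DoubleCommutatorBoundedBy A₁ J₁' γ₁)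
    (hcomm₂ : DoubleCommutatorBoundedBy A₂ J₂ γ₂) (hcomm₂' : DoubleCommutatorBoundedBy A₂ J₂' γ₂)
    -- lower bounds on the range of `J'_l`
    (α₁ α₂ : ℝ) (hα₁ : 0 < α₁) (hα₂ : 0 < α₂)
    (hlower₁ : ∀ u ∈ A₁.domain, ∀ h : J₁' u ∈ A₁.domain,
      α₁ * ‖J₁' u‖ ^ 2 ≤ (⟪A₁ ⟨J₁' u, h⟩, J₁' u⟫_ℂ).re)
    (hlower₂ : ∀ u ∈ A₂.domain, ∀ h : J₂' u ∈ A₂.domain,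
      α₂ * ‖J₂' u‖ ^ 2 ≤ (⟪A₂ ⟨J₂' u, h⟩, J₂' u⟫_ℂ).re)
    -- comparison of the quadratic forms
    (β₁ β₂ ε₁ ε₂ : ℝ) (hβ₁ : 1 ≤ β₁) (hβ₂ : 1 ≤ β₂) (hε₁ : 0 < ε₁) (hε₂ : 0 < ε₂)
    (hform₁ : ∀ (u : H₀) (h₁ : i₁ (J u) ∈ A₁.domain) (h₂ : i₂ (J u) ∈ A₂.domain),
      (⟪A₂ ⟨i₂ (J u), h₂⟩, i₂ (J u)⟫_ℂ).re ≤
        β₁ * (⟪A₁ ⟨i₁ (J u), h₁⟩, i₁ (J u)⟫_ℂ).re + ε₁ * ‖i₁ (J u)‖ ^ 2)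
    (hform₂ : ∀ (u : H₀) (h₁ : i₁ (J u) ∈ A₁.domain) (h₂ : i₂ (J u) ∈ A₂.domain),
      (⟪A₁ ⟨i₁ (J u), h₁⟩, i₁ (J u)⟫_ℂ).re ≤
        β₂ * (⟪A₂ ⟨i₂ (J u), h₂⟩, i₂ (J u)⟫_ℂ).re + ε₂ * ‖i₂ (J u)‖ ^ 2)
    -- the intervals
    (a₁ b₁ a₂ b₂ : ℝ) (hab₁ : a₁ < b₁)
    (ha₂ : a₂ = ρ * (β₁ * (a₁ + γ₁ + (a₁ + γ₁ - l₁) ^ 2 / (α₁ - a₁ - γ₁)) + ε₁))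
    (hb₂ : b₂ = (β₂⁻¹ * (b₁ * ρ⁻¹ - ε₂) * (α₂ - γ₂) - α₂ * γ₂ + 2 * l₂ * γ₂ - l₂ ^ 2) /
      (α₂ - 2 * l₂ + β₂⁻¹ * (b₁ * ρ⁻¹ - ε₂)))
    (hα₁_gt : a₁ + γ₁ < α₁) (hα₂_gt : b₂ + γ₂ < α₂) (hab₂ : a₂ < b₂)
    (ha₂_nonneg : 0 ≤ a₂)
    (hgap : ∀ x ∈ Set.Ioo a₁ b₁, (x : ℂ) ∉ opSpectrum A₁) :
    ∀ r₁ ∈ Set.Ioo a₁ b₁, ∀ r₂ ∈ Set.Ioo a₂ b₂,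
      MurrayVonNeumannEquivalentIn (𝔄₀.map π)
        (V₁.conjStarAlgEquiv (spectralProjection A₁ r₁))
        (V₂.conjStarAlgEquiv (spectralProjection A₂ r₂)) := by
  have hγ₁ := hcomm₁.nonneg
  have hγ₂ := hcomm₂.nonneg
  have hJ₁sa : IsSelfAdjoint J₁ := .of_nonneg hJ₁_nonneg
  have hJ₁sa' : IsSelfAdjoint J₁' := .of_nonneg hJ₁'_nonneg
  have hJ₂sa : IsSelfAdjoint J₂ := .of_nonneg hJ₂_nonneg
  have hJ₂sa' : IsSelfAdjoint J₂' := .of_nonneg hJ₂'_nonneg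
  have hp₁ : ∀ u, p₁ (i₁ u) = u := fun u => congrArg (fun T => T u) hpi₁
  have hp₂ : ∀ u, p₂ (i₂ u) = u := fun u => congrArg (fun T => T u) hpi₂
  set B : H₁ →L[ℂ] H₂ := i₂ ∘L J ∘L p₁ with hB
  set B' : H₂ →L[ℂ] H₁ := i₁ ∘L J ∘L p₂ with hB'
  have hadj : ContinuousLinearMap.adjoint B' = B := by
    rw [← hJ_adj, ContinuousLinearMap.adjoint_adjoint]
  -- Because `p₁ i₁ = p₂ i₂ = 1`, both `B* B` and `J₁²` equal `i₁ J² p₁`.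
  have hnorm : ∀ u, ‖B u‖ = ‖J₁ u‖ := norm_apply_eq_of_adjoint_comp hJ₁sa fun u => by
    rw [hJ_adj, hJ₁]; simp [hB, hB', hp₁, hp₂]
  have hnorm' : ∀ u, ‖B' u‖ = ‖J₂ u‖ := norm_apply_eq_of_adjoint_comp hJ₂sa fun u => by
    rw [hadj, hJ₂]; simp [hB, hB', hp₁, hp₂]
  have hf₁ : ∀ u : H₁, ∀ h1 : J₁ u ∈ A₁.domain, ∃ h2 : B u ∈ A₂.domain,
      (⟪A₂ ⟨B u, h2⟩, B u⟫_ℂ).re ≤ β₁ * (⟪A₁ ⟨J₁ u, h1⟩, J₁ u⟫_ℂ).re + ε₁ * ‖J₁ u‖ ^ 2 := by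
    subst hJ₁
    exact fun u h1 => ⟨(hdom _).1 h1, hform₁ _ h1 _⟩
  have hf₂ : ∀ u : H₂, ∀ h1 : J₂ u ∈ A₂.domain, ∃ h2 : B' u ∈ A₁.domain,
      (⟪A₁ ⟨B' u, h2⟩, B' u⟫_ℂ).re ≤ β₂ * (⟪A₂ ⟨J₂ u, h1⟩, J₂ u⟫_ℂ).re + ε₂ * ‖J₂ u‖ ^ 2 := by
    subst hJ₂
    exact fun u h1 => ⟨(hdom _).2 h1, hform₂ _ _ h1⟩
  have hn₁ : β₁ * (a₁ + γ₁) + ε₁ ≤ a₂ := form_bound_le_upper hρ hβ₁ hα₁_gt ha₂ ha₂_nonneg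
  have hn₂ : β₂ * (b₂ + γ₂) + ε₂ ≤ b₁ := form_bound_le_lower hρ hβ₂ hε₂ hγ₂ hα₂_gt hb₂
    (ha₂_nonneg.trans_lt hab₂)
  intro r₁ hr₁ r₂ hr₂
  have hgap₁ : ∀ x ∈ Set.Ioo a₁ b₁, ¬ InSpectrum A₁ x := fun x hx =>
    not_inSpectrum_of_notMem_opSpectrum hA₁ (hgap x hx)
  have hconst : ∀ s ∈ Set.Ioo a₁ b₁, spectralProjection A₁ s = spectralProjection A₁ r₁ :=
    fun s hs => spectralProjection_eq_of_gap hA₁ hbelow₁ hgap₁ hs hr₁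
  set Φ₁ := V₁.conjStarAlgEquiv with hΦ₁
  set Φ₂ := V₂.conjStarAlgEquiv with hΦ₂
  set M := bicommutant (NonUnitalStarAlgHom.range π) with hM
  have hmem : ∀ a : 𝔄, π a ∈ M := fun a => mem_bicommutant_of_mem ⟨a, rfl⟩
  set P := Φ₁ (spectralProjection A₁ r₁) with hP
  set Q : ℝ → (H →L[ℂ] H) := fun s => Φ₂ (spectralProjection A₂ s) with hQ
  have hPp : IsStarProjection P := (isStarProjection_spectralProjection A₁ r₁).map Φ₁
  have hQp : ∀ s, IsStarProjection (Q s) := fun s =>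
    (isStarProjection_spectralProjection A₂ s).map Φ₂
  have hPm : P ∈ 𝔄₀.map π := conj_spectralProjection_mem_map hπ h𝔄₀ V₁ hA₁ hbelow₁
    (hheat₁ 1 one_pos) hr₁.2 fun x hx => hgap₁ x ⟨hr₁.1.trans hx.1, hx.2⟩
  have hPM : P ∈ M := by
    obtain ⟨a, -, ha⟩ := NonUnitalStarSubalgebra.mem_map.1 hPm
    exact ha ▸ hmem a
  have hQM : ∀ s, Q s ∈ M := fun s => by
    obtain ⟨a, -, ha⟩ := hheat₂ 1 one_pos
    exact conj_spectralProjection_mem_bicommutant V₂ hA₂ hbelow₂ ⟨a, ha⟩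
  have hfin : τ P < ∞ := by
    obtain ⟨a, -, ha⟩ := hheat₁ 1 one_pos
    exact trace_conj_spectralProjection_lt_top hτ V₁ hA₁ hbelow₁ hPM (ha ▸ hmem a) (hτ₁ 1 one_pos)
  set W : H →L[ℂ] H := (V₂ : H₂ →L[ℂ] H) ∘L B ∘L (V₁.symm : H →L[ℂ] H₁) with hW
  have hWapp : ∀ x, W x = V₂ (B (V₁.symm x)) := fun x => rfl
  have hWs : ∀ x, star W x = V₁ (B' (V₂.symm x)) := by
    intro x
    refine ext_inner_left ℂ fun y => ?_
    have h1 := V₂.inner_map_map (B (V₁.symm y)) (V₂.symm x)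
    have h2 := V₁.inner_map_map (V₁.symm y) (B' (V₂.symm x))
    rw [V₂.apply_symm_apply] at h1
    rw [V₁.apply_symm_apply] at h2
    rw [ContinuousLinearMap.star_eq_adjoint, ContinuousLinearMap.adjoint_inner_right, hWapp, h1, h2,
      ← hJ_adj, ContinuousLinearMap.adjoint_inner_right]
  -- the two comparisons of the spectral subspaces
  have hlow₁ : ∀ s ∈ Set.Ioo a₂ b₂, ∃ c : ℝ, 0 < c ∧ ∀ x, c * ‖P x‖ ^ 2 ≤ ‖(Q s * W * P) x‖ ^ 2 := by
    intro s hs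
    obtain ⟨c, hc, h⟩ := exists_lower_bound_spectralProjection hJ₁sa hJ₁sa' hJ₁' hcomm₁ hcomm₁' hbelow₁
      (hl₁.trans_lt hα₁) hlower₁ hα₁_gt hA₂ hbelow₂ hnorm (zero_le_one.trans hβ₁) hf₁
      (hn₁.trans_lt hs.1)
    refine ⟨c, hc, fun x => ?_⟩
    set u := spectralProjection A₁ r₁ (V₁.symm x) with hu
    have hdomu : u ∈ A₁.domain :=
      (mem_domain_of_mem_spectralSubspace hA₁ hbelow₁ (spectralProjection_mem A₁ r₁ _)).1
    -- The projection is constant across the gap, so `u` lies in the spectral subspace for `a₁ + δ`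
    -- with `δ` arbitrarily small, which improves the bound from `r₁` to `a₁`.
    have hle : (⟪A₁ ⟨u, hdomu⟩, u⟫_ℂ).re ≤ a₁ * ‖u‖ ^ 2 := by
      refine le_of_forall_pos_le_add fun ε hε => ?_
      obtain ⟨δ, hδ0, hδ⟩ := exists_between (lt_min (div_pos hε (show 0 < ‖u‖ ^ 2 + 1 by positivity))
        (sub_pos.2 hab₁))
      have h1 := hδ.trans_le (min_le_left _ _)
      have h2 := hδ.trans_le (min_le_right _ _)
      have h3 : u ∈ spectralSubspace A₁ (a₁ + δ) := by
        rw [hu, ← hconst (a₁ + δ) ⟨by linarith, by linarith⟩]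
        exact spectralProjection_mem _ _ _
      have h4 := (mem_domain_of_mem_spectralSubspace hA₁ hbelow₁ h3).2.2
      rw [lt_div_iff₀ (by positivity)] at h1
      linarith
    have h1 := h ⟨u, hdomu⟩ hle
    have h2 : P x = V₁ u := rfl
    have h3 : (Q s * W * P) x = V₂ (spectralProjection A₂ s (B u)) := by
      rw [mul_apply_eq_comp, mul_apply_eq_comp, h2, hWapp, V₁.symm_apply_apply]
      simp [hQ, hΦ₂]
    rw [h2, h3, V₁.norm_map, V₂.norm_map]
    exact h1
  have hlow₂ : ∀ s ∈ Set.Ioo a₂ b₂,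
      ∃ c : ℝ, 0 < c ∧ ∀ x, c * ‖Q s x‖ ^ 2 ≤ ‖(P * star W * Q s) x‖ ^ 2 := by
    intro s hs
    have hκ : β₂ * (s + γ₂) + ε₂ < b₁ := by
      have := mul_lt_mul_of_pos_left hs.2 (zero_lt_one.trans_le hβ₂)
      linarith
    -- Above the transplanted form bound and inside the gap, where `E₁(μ) = E₁(r₁)`.
    obtain ⟨μ, hμ, hμb⟩ := exists_between (max_lt hκ hab₁)
    have hμ1 := (le_max_left _ _).trans_lt hμ
    have hμ2 := (le_max_right _ _).trans_lt hμ
    obtain ⟨c, hc, h⟩ := exists_lower_bound_spectralProjection hJ₂sa hJ₂sa' hJ₂' hcomm₂ hcomm₂' hbelow₂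
      (hl₂.trans_lt hα₂) hlower₂ (by linarith [hs.2]) hA₁ hbelow₁ hnorm' (zero_le_one.trans hβ₂) hf₂
      hμ1
    rw [hconst μ ⟨hμ2, hμb⟩] at h
    refine ⟨c, hc, fun x => ?_⟩
    set u := spectralProjection A₂ s (V₂.symm x) with hu
    obtain ⟨hdomu, -, hle⟩ :=
      mem_domain_of_mem_spectralSubspace hA₂ hbelow₂ (spectralProjection_mem A₂ s (V₂.symm x))
    have h1 := h ⟨u, hdomu⟩ hle
    have h2 : Q s x = V₂ u := rfl
    have h3 : (P * star W * Q s) x = V₁ (spectralProjection A₁ r₁ (B' u)) := by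
      rw [mul_apply_eq_comp, mul_apply_eq_comp, h2, hWs, V₂.symm_apply_apply]
      simp [hP, hΦ₁]
    rw [h2, h3, V₁.norm_map, V₂.norm_map]
    exact h1
  have hτQ : ∀ s ∈ Set.Ioo a₂ b₂, τ P = τ (Q s) := by
    intro s hs
    obtain ⟨c, hc, h⟩ := hlow₁ s hs
    obtain ⟨c', hc', h'⟩ := hlow₂ s hs
    refine le_antisymm ?_ ?_
    · exact hτ.le_of_lower_bound (mul_mem (mul_mem (hQM s) hJ_mem) hPM) (hQM s) hPp (hQp s)
        (by rw [mul_assoc _ P P, hPp.isIdempotentElem.eq])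
        (by rw [← mul_assoc, ← mul_assoc, (hQp s).isIdempotentElem.eq]) hc h
    · exact hτ.le_of_lower_bound (mul_mem (mul_mem hPM (star_mem hJ_mem)) (hQM s)) hPM (hQp s) hPp
        (by rw [mul_assoc _ (Q s) (Q s), (hQp s).isIdempotentElem.eq])
        (by rw [← mul_assoc, ← mul_assoc, hPp.isIdempotentElem.eq]) hc' h'
  have hQeq : ∀ s ∈ Set.Ioo a₂ b₂, ∀ t ∈ Set.Ioo a₂ b₂, s ≤ t →
      spectralProjection A₂ s = spectralProjection A₂ t := by
    intro s hs t ht hst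
    have h1 : star (Q s) * Q s = Q s := by
      rw [(hQp s).isSelfAdjoint.star_eq, (hQp s).isIdempotentElem.eq]
    have h2 : Q t * Q s = Q s := by
      rw [hQ]
      dsimp only
      rw [← map_mul]
      congr 1
      ext x
      exact spectralProjection_apply_of_mem (spectralSubspace_mono hst (spectralProjection_mem A₂ s x))
    -- Here `Q s` serves as its own partial isometry: a subprojection of `Q t` with the same finite
    -- trace is all of `Q t`.
    have h3 := hτ.mul_star_self_eq (hQM s) (hQM t) (hQp s) (hQp t) h1 h2
      (by rw [← hτQ s hs, ← hτQ t ht]) (by rw [← hτQ s hs]; exact hfin)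
    rw [(hQp s).isSelfAdjoint.star_eq, (hQp s).isIdempotentElem.eq] at h3
    exact Φ₂.injective h3
  obtain ⟨s, hs1, hs2⟩ := exists_between hr₂.1
  obtain ⟨t, ht1, ht2⟩ := exists_between hr₂.2
  -- Equality of the projections at `r₂` and `t` gives the gap of `A₂` that puts `Q r₂` into
  -- `π(𝔄₀)`.
  have hgap₂ := not_inSpectrum_of_spectralProjection_eq hA₂ hbelow₂ (hQeq r₂ hr₂ t ⟨hr₂.1.trans ht1, ht2⟩ ht1.le)
  have hQm : Q r₂ ∈ 𝔄₀.map π := conj_spectralProjection_mem_map hπ h𝔄₀ V₂ hA₂ hbelow₂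
    (hheat₂ 1 one_pos) ht1 hgap₂
  obtain ⟨p, -, hp⟩ := NonUnitalStarSubalgebra.mem_map.1 hPm
  obtain ⟨q, -, hq⟩ := NonUnitalStarSubalgebra.mem_map.1 hQm
  -- The operator `W` is only in the von Neumann algebra, but `Q r₂ = π q` multiplies it into
  -- `π(𝔄)`, where density of `𝔄₀` applies.
  obtain ⟨b, hb⟩ := hJ_mul q
  have hT : π (b * p) = Q r₂ * W * P := by rw [map_mul, hb, hp, hq]
  obtain ⟨c, hc, h⟩ := hlow₁ r₂ hr₂
  exact murrayVonNeumannEquivalentIn_of_lower_bound hπ h𝔄₀ hτ hPp (hQp r₂) hPm hQm (t := b * p)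
    (by rw [hT, mul_assoc _ P P, hPp.isIdempotentElem.eq])
    (by rw [hT, ← mul_assoc, ← mul_assoc, (hQp r₂).isIdempotentElem.eq]) hc
    (by rw [hT]; exact h) (hτQ r₂ hr₂).ge hfin
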